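/- There are a real-RAM program $P$ and absolute constants $C\ge 1$, $A$, $B$ such that the following holds for all integers $k,t\ge 1$ and $N\ge 2kt$ and all real $0<\varepsilon\le 1/2$. A distribution over $[N]$ is *$t$-modal* if $[N]$ can be partitioned into at most $t$ intervals on each of which its (conditional) pmf is unimodal, i.e. non-decreasing up to some point and non-increasing from there on. Let $\mathcal C$ be the class of $k$-mixtures $\sum_{i=1}^k w_i p_i$ ($w_i\ge 0$, $\sum_i w_i=1$) of $t$-modal distributions $p_i$ over $[N]$, and for a pmf $f$ on $[N]$ put $\mathrm{OPT}_{\mathcal C}(f)=\inf_{q\in\mathcal C}\|q-f\|_1$. Given $N,k,t,\varepsilon$ and i.i.d. samples from an unknown distribution $f$ over $[N]$ ($f$ is arbitrary and need not be in $\mathcal C$), $P$ outputs a hypothesis $h:[N]\to\mathbb R$, described as a list of constant pieces, such that with probability at least $9/10$ $$\|h-f\|_1\le C\cdot \mathrm{OPT}_{\mathcal C}(f)+\varepsilon .$$ On every sequence of samples, $P$ draws at most $$A\cdot\frac{kt\log(N/kt)}{\varepsilon^3}$$ samples and halts after at most $$B\cdot\frac{kt\log(N/kt)}{\varepsilon^3}\,\log(1/\varepsilon)$$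 steps. A step is one arithmetic operation, comparison, memory access or output operation on natural numbers or exact reals (natural numbers: addition and subtraction only; no rounding of reals), and drawing $n$ samples takes $n+1$ steps and delivers the $n$ samples in sorted order, i.e. the time for sorting the samples is not counted. -/

import Mathlib

open MeasureTheory

/-! ### A real RAM with access to random samples -/

namespace RealRAM

/-- Memory of the machine: natural-number registers and real registers, natural-number arrays and
real arrays, the number of samples drawn so far, and the output tape. Registers and arrays are
named by natural numbers, so that a program uses finitely many of them. -/
structure State where
  nreg : ℕ → ℕ
  rreg : ℕ → ℝ
  narr : ℕ → ℕ → ℕ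
  rarr : ℕ → ℕ → ℝ
  drawn : ℕ
  out : List (ℕ × ℝ)

/-- Atomic instructions. Natural numbers support only constants, addition and truncated
subtraction; reals support the four field operations (`x / 0 = 0`). There is no rounding from
reals to natural numbers. -/
inductive Instr where
  /-- `n_i := c` -/
  | nconst (i c : ℕ)
  /-- `n_i := n_j + n_l` -/
  | nadd (i j l : ℕ)
  /-- `n_i := n_j - n_l` -/
  | nsub (i j l : ℕ)
  /-- `n_i := A_a[n_j]` -/
  | nload (i a j : ℕ)
  /-- `A_a[n_j] := n_i` -/
  | nstore (a j i : ℕ)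
  /-- `r_i := n_j` -/
  | rcast (i j : ℕ)
  /-- `r_i := r_j + r_l` -/
  | radd (i j l : ℕ)
  /-- `r_i := r_j - r_l` -/
  | rsub (i j l : ℕ)
  /-- `r_i := r_j * r_l` -/
  | rmul (i j l : ℕ)
  /-- `r_i := r_j / r_l` -/
  | rdiv (i j l : ℕ)
  /-- `r_i := B_a[n_j]` -/
  | rload (i a j : ℕ)
  /-- `B_a[n_j] := r_i` -/
  | rstore (a j i : ℕ)
  /-- draw `n_i` fresh samples and write them, in sorted order, to `A_a[0], A_a[1], …` -/
  | draw (i a : ℕ)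
  /-- append the pair `(n_i, r_j)` to the output -/
  | emit (i j : ℕ)

/-- Tests of branches and loops: comparisons of two registers of the same sort. -/
inductive Test where
  | nlt (i j : ℕ)
  | nle (i j : ℕ)
  | rlt (i j : ℕ)
  | rle (i j : ℕ)

/-- Programs: finite flow charts in structured form. -/
inductive Prog where
  | atom (c : Instr)
  | seq (p q : Prog)
  | cond (b : Test) (p q : Prog)
  | loop (b : Test) (p : Prog)

/-- Truth of a test. -/
def Test.Holds (s : State) : Test → Prop
  | .nlt i j => s.nreg i < s.nreg j
  | .nle i j => s.nreg i ≤ s.nreg j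
  | .rlt i j => s.rreg i < s.rreg j
  | .rle i j => s.rreg i ≤ s.rreg j

/-- The samples `ω d, …, ω (d + c - 1)` in non-decreasing order. -/
def sortedBatch (ω : ℕ → ℕ) (d c : ℕ) : List ℕ :=
  ((List.range c).map fun i => ω (d + i)).insertionSort (· ≤ ·)

/-- Effect of an atomic instruction when the stream of samples is `ω`. -/
noncomputable def Instr.apply (ω : ℕ → ℕ) (s : State) : Instr → State
  | .nconst i c => { s with nreg := Function.update s.nreg i c }
  | .nadd i j l => { s with nreg := Function.update s.nreg i (s.nreg j + s.nreg l) }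
  | .nsub i j l => { s with nreg := Function.update s.nreg i (s.nreg j - s.nreg l) }
  | .nload i a j => { s with nreg := Function.update s.nreg i (s.narr a (s.nreg j)) }
  | .nstore a j i =>
      { s with narr := Function.update s.narr a
                (Function.update (s.narr a) (s.nreg j) (s.nreg i)) }
  | .rcast i j => { s with rreg := Function.update s.rreg i (s.nreg j : ℝ) }
  | .radd i j l => { s with rreg := Function.update s.rreg i (s.rreg j + s.rreg l) }
  | .rsub i j l => { s with rreg := Function.update s.rreg i (s.rreg j - s.rreg l) }
  | .rmul i j l => { s with rreg := Function.update s.rreg i (s.rreg j * s.rreg l) }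
  | .rdiv i j l => { s with rreg := Function.update s.rreg i (s.rreg j / s.rreg l) }
  | .rload i a j => { s with rreg := Function.update s.rreg i (s.rarr a (s.nreg j)) }
  | .rstore a j i =>
      { s with rarr := Function.update s.rarr a
                (Function.update (s.rarr a) (s.nreg j) (s.rreg i)) }
  | .draw i a =>
      { s with
        narr := Function.update s.narr a fun m =>
          (sortedBatch ω s.drawn (s.nreg i)).getD m (s.narr a m)
        drawn := s.drawn + s.nreg i }
  | .emit i j => { s with out := s.out ++ [(s.nreg i, s.rreg j)] }

/-- Running time of an atomic instruction: one step, and one further step for every sample drawn. -/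
def Instr.cost (s : State) : Instr → ℕ
  | .draw i _ => s.nreg i + 1
  | _ => 1

/-- `Exec ω p s T s'`: with the stream of samples `ω`, the program `p` started in state `s` halts
after `T` steps in state `s'`. Every evaluation of a test costs one step. -/
inductive Exec (ω : ℕ → ℕ) : Prog → State → ℕ → State → Prop where
  | atom (c : Instr) (s : State) : Exec ω (.atom c) s (c.cost s) (c.apply ω s)
  | seq {p q : Prog} {s s' s'' : State} {T T' : ℕ} :
      Exec ω p s T s' → Exec ω q s' T' s'' → Exec ω (.seq p q) s (T + T') s''
  | cond_true {b : Test} {p q : Prog} {s s' : State} {T : ℕ} :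
      b.Holds s → Exec ω p s T s' → Exec ω (.cond b p q) s (T + 1) s'
  | cond_false {b : Test} {p q : Prog} {s s' : State} {T : ℕ} :
      ¬ b.Holds s → Exec ω q s T s' → Exec ω (.cond b p q) s (T + 1) s'
  | loop_true {b : Test} {p : Prog} {s s' s'' : State} {T T' : ℕ} :
      b.Holds s → Exec ω p s T s' → Exec ω (.loop b p) s' T' s'' →
        Exec ω (.loop b p) s (T + T' + 1) s''
  | loop_false {b : Test} {p : Prog} {s : State} :
      ¬ b.Holds s → Exec ω (.loop b p) s 1 s

/-- The machine is deterministic once the samples are fixed. -/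
theorem Exec.deterministic {ω : ℕ → ℕ} {p : Prog} {s s₁ s₂ : State} {T₁ T₂ : ℕ}
    (h₁ : Exec ω p s T₁ s₁) (h₂ : Exec ω p s T₂ s₂) : T₁ = T₂ ∧ s₁ = s₂ := by
  induction h₁ generalizing T₂ s₂ with
  | atom c s => cases h₂; exact ⟨rfl, rfl⟩
  | seq _ _ ih ih' =>
    cases h₂ with
    | seq k k' =>
      obtain ⟨rfl, rfl⟩ := ih k
      obtain ⟨rfl, rfl⟩ := ih' k'
      exact ⟨rfl, rfl⟩
  | cond_true hb _ ih =>
    cases h₂ with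
    | cond_true _ k => obtain ⟨rfl, rfl⟩ := ih k; exact ⟨rfl, rfl⟩
    | cond_false hn _ => exact absurd hb hn
  | cond_false hb _ ih =>
    cases h₂ with
    | cond_true hp _ => exact absurd hp hb
    | cond_false _ k => obtain ⟨rfl, rfl⟩ := ih k; exact ⟨rfl, rfl⟩
  | loop_true hb _ _ ih ih' =>
    cases h₂ with
    | loop_true _ k k' =>
      obtain ⟨rfl, rfl⟩ := ih k
      obtain ⟨rfl, rfl⟩ := ih' k'
      exact ⟨rfl, rfl⟩
    | loop_false hn => exact absurd hb hn
  | loop_false hb =>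
    cases h₂ with
    | loop_true hp _ _ => exact absurd hp hb
    | loop_false _ => exact ⟨rfl, rfl⟩

/-- Initial state: `N`, `k`, `t` stand in the natural-number registers `0`, `1`, `2`, and `ε` in the
real register `0`; everything else is zero or empty. -/
def start (N k t : ℕ) (ε : ℝ) : State where
  nreg := fun i => if i = 0 then N else if i = 1 then k else if i = 2 then t else 0
  rreg := fun i => if i = 0 then ε else 0
  narr := fun _ _ => 0
  rarr := fun _ _ => 0
  drawn := 0
  out := []

/-- The hypothesis that an output `(e₁, v₁), (e₂, v₂), …` describes: the piecewise constant function
whose value at `x` is the `v_m` with the first `m` such that `x ≤ e_m`, and `0` if there is none. -/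
noncomputable def hypothesis {N : ℕ} (o : List (ℕ × ℝ)) (x : Fin N) : ℝ :=
  match o.find? (fun e => decide ((x : ℕ) ≤ e.1)) with
  | some e => e.2
  | none => 0

end RealRAM

/-! ### Distributions over an ordered domain with `N` points

The domain is `Fin N`, i.e. the points are numbered from `0`. -/

/-- The `ℓ₁`-distance of two functions on the domain. -/
noncomputable def l1Dist {N : ℕ} (p q : Fin N → ℝ) : ℝ := ∑ x, |p x - q x|

/-- `p` is unimodal on `J`. This is invariant under scaling `p`, so it says that the conditional pmf
on `J` is unimodal whenever `J` has positive mass, and holds if `p` vanishes on `J`. -/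
def UnimodalOn {N : ℕ} (p : Fin N → ℝ) (J : Set (Fin N)) : Prop :=
  ∃ j ∈ J, MonotoneOn p (J ∩ Set.Iic j) ∧ AntitoneOn p (J ∩ Set.Ici j)

/-- `p` is the pmf of a `t`-modal distribution: the domain has a partition into at most `t`
(non-empty) intervals on each of which `p` is unimodal. -/
def IsModal {N : ℕ} (t : ℕ) (p : Fin N → ℝ) : Prop :=
  p ∈ stdSimplex ℝ (Fin N) ∧
    ∃ P : Finpartition (Finset.univ : Finset (Fin N)),
      P.parts.card ≤ t ∧
        ∀ J ∈ P.parts, (J : Set (Fin N)).OrdConnected ∧ UnimodalOn p (J : Set (Fin N))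

/-- The class of pmfs of `k`-mixtures of `t`-modal distributions. -/
def modalMixtures (N k t : ℕ) : Set (Fin N → ℝ) :=
  {q | ∃ w ∈ stdSimplex ℝ (Fin k), ∃ p : Fin k → Fin N → ℝ,
    (∀ i, IsModal t (p i)) ∧ q = fun x => ∑ i, w i * p i x}

/-- The distance from `f` to the class `𝒞`. -/
noncomputable def OPT {N : ℕ} (𝒞 : Set (Fin N → ℝ)) (f : Fin N → ℝ) : ℝ :=
  sInf ((fun q => l1Dist q f) '' 𝒞)

/-- Started in state `s`, the program `P` learns the class `𝒞` agnostically with factor `C` and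
accuracy `ε`: for every distribution `f` on the domain, when the samples are independent with law
`f`, then with probability at least `9/10` it halts with a hypothesis `h` such that
`‖h - f‖₁ ≤ C * OPT 𝒞 f + ε`. -/
def AgnosticallyLearns {N : ℕ} (P : RealRAM.Prog) (s : RealRAM.State)
    (𝒞 : Set (Fin N → ℝ)) (C ε : ℝ) : Prop :=
  ∀ f : PMF (Fin N),
    9 / 10 ≤ (Measure.infinitePi fun _ : ℕ => f.toMeasure).real
      {ω : ℕ → Fin N | ∃ (T : ℕ) (s' : RealRAM.State),
        RealRAM.Exec (fun i => (ω i : ℕ)) P s T s' ∧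
          l1Dist (RealRAM.hypothesis s'.out) (fun x => (f x).toReal) ≤
            C * OPT 𝒞 (fun x => (f x).toReal) + ε}

/-! The proof rests on approximating mixtures by histograms, on a bound for sampling noise that is
additive over disjoint intervals, and on a greedy fit that takes time linear in the number of
samples.

Approximation. Let `L` be least with `N ≤ k * t * 2 ^ L`. The multiples of `2 ^ L` together with the
starts and modes of all unimodal pieces of all components cut the domain into `O(kt)` cells of
length at most `2 ^ L`, and every component is monotone on every cell. On a cell, Birgé's rounding
on geometrically growing intervals counted from the higher end has relative error `2 * δ` and uses
`O(L/δ)` values. Since the intervals are the same for all components, the rounded mixture has only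
`O(ktL/δ)` jumps (`exists_histogram_near`).

Noise. For every `l > 0` the increment of the error of the empirical distribution function over any
interval is at most `2 * l` plus the increment of one random non-decreasing function, `fluctuation`,
whose total has expectation at most `1/(l*m) + 2/√m` (`empCdf_increment_le`,
`sampleExp_fluctuation_le`). Disjoint intervals therefore share one noise budget and pay only `2 *
l` each. The error process is split into a martingale and a drift governed by the hazard rate; the
martingale is cut into blocks of movement at least `l`.

Fit. The empirical distribution function is covered greedily by lines of tolerance `4 * l`; their
slopes are the output. A block is closed only when no slope fits it. Then the comparison histogram
`g` jumps inside the block, or the noise there is at least `2 * l`, so the cost of the block can be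
charged to jumps and noise (`GreedyFit.sum_abs_sub_le`). The distance from `f` to `g` is treated as
further noise, which gives the agnostic guarantee.

With `W = k * t * L` and `δ` of order `ε`, there are about `W/ε` jumps, so `l` is of order `ε²/W`;
making `1/(l*m)` of order `ε` then requires `m` of order `W/ε³`. -/

/-! ### Expectations over finitely many independent samples -/

/-- Expectation of `G` over `m` independent samples with pmf `p`. -/
noncomputable def sampleExp {α : Type*} [Fintype α] (p : α → ℝ) (m : ℕ)
    (G : (Fin m → α) → ℝ) : ℝ :=
  ∑ ω : Fin m → α, (∏ i, p (ω i)) * G ω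

section SampleExp

variable {α : Type*} [Fintype α] {p : α → ℝ} {m : ℕ}

theorem sampleExp_add (G H : (Fin m → α) → ℝ) :
    sampleExp p m (fun ω => G ω + H ω) = sampleExp p m G + sampleExp p m H := by
  simp [sampleExp, mul_add, Finset.sum_add_distrib]

theorem sampleExp_const_mul (c : ℝ) (G : (Fin m → α) → ℝ) :
    sampleExp p m (fun ω => c * G ω) = c * sampleExp p m G := by
  simp only [sampleExp, Finset.mul_sum]
  exact Finset.sum_congr rfl fun _ _ => by ring

theorem sampleExp_sum {ι : Type*} (s : Finset ι) (G : ι → (Fin m → α) → ℝ) :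
    sampleExp p m (fun ω => ∑ j ∈ s, G j ω) = ∑ j ∈ s, sampleExp p m (G j) := by
  simp only [sampleExp, Finset.mul_sum]
  exact Finset.sum_comm

theorem sampleExp_mono (hp : ∀ a, 0 ≤ p a) {G H : (Fin m → α) → ℝ} (h : ∀ ω, G ω ≤ H ω) :
    sampleExp p m G ≤ sampleExp p m H :=
  Finset.sum_le_sum fun ω _ =>
    mul_le_mul_of_nonneg_left (h ω) (Finset.prod_nonneg fun _ _ => hp _)

theorem sampleExp_one (hp : ∑ a, p a = 1) : sampleExp p m (fun _ => 1) = 1 := by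
  classical
  have := (Finset.prod_univ_sum (fun _ : Fin m => (Finset.univ : Finset α)) fun _ a => p a)
  simp only [hp, Finset.prod_const_one, Fintype.piFinset_univ] at this
  simp [sampleExp, ← this]

/-- A factor that depends on the `i`-th sample only splits off. -/
theorem sampleExp_mul_of_invariant (hp : ∑ a, p a = 1) (i : Fin m) (u : α → ℝ)
    (G : (Fin m → α) → ℝ) (hG : ∀ ω a, G (Function.update ω i a) = G ω) :
    sampleExp p m (fun ω => u (ω i) * G ω) = (∑ a, p a * u a) * sampleExp p m G := by
  obtain ⟨n, rfl⟩ : ∃ n, m = n + 1 := ⟨m - 1, by have := i.2; omega⟩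
  -- Fubini with the `i`-th sample as the inner summation variable.
  have key : ∀ H : (Fin (n + 1) → α) → ℝ, sampleExp p (n + 1) H =
      ∑ ω : Fin n → α, (∏ j, p (ω j)) * ∑ a, p a * H (i.insertNth a ω) := by
    intro H
    rw [sampleExp, ← (Fin.insertNthEquiv (fun _ => α) i).sum_comp, Fintype.sum_prod_type_right]
    refine Finset.sum_congr rfl fun ω _ => ?_
    rw [Finset.mul_sum]
    refine Finset.sum_congr rfl fun a _ => ?_
    simp only [Fin.insertNthEquiv, Equiv.coe_fn_mk]
    rw [Fin.prod_univ_succAbove _ i]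
    simp only [Fin.insertNth_apply_same, Fin.insertNth_apply_succAbove]
    ring
  rw [key, key, Finset.mul_sum]
  refine Finset.sum_congr rfl fun ω _ => ?_
  have hc : ∀ a b, G (i.insertNth a ω) = G (i.insertNth b ω) := fun a b => by
    rw [← hG (i.insertNth b ω) a, Fin.update_insertNth]
  have hm : ∀ a, ∑ b, p b * G (i.insertNth b ω) = G (i.insertNth a ω) := fun a => by
    rw [← one_mul (G (i.insertNth a ω)), ← hp, Finset.sum_mul]
    exact Finset.sum_congr rfl fun b _ => by rw [hc b a]
  have : ∑ a, p a * (u ((i.insertNth a ω : Fin (n + 1) → α) i) * G (i.insertNth a ω)) =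
      (∑ a, p a * u a) * ∑ b, p b * G (i.insertNth b ω) := by
    rw [Finset.sum_mul]
    refine Finset.sum_congr rfl fun a _ => ?_
    rw [hm a, Fin.insertNth_apply_same, mul_assoc]
  rw [this]; ring

/-- Second moment of a sum of independent centred terms. -/
theorem sampleExp_sum_sq (hp : ∑ a, p a = 1) (u : α → ℝ) (hu : ∑ a, p a * u a = 0) :
    sampleExp p m (fun ω => (∑ i, u (ω i)) ^ 2) = m * ∑ a, p a * u a ^ 2 := by
  have h1 : ∀ ω : Fin m → α, (∑ i, u (ω i)) ^ 2 = ∑ i, ∑ j, u (ω i) * u (ω j) := fun ω => by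
    rw [sq, Finset.sum_mul_sum]
  have h2 : ∀ i j : Fin m, sampleExp p m (fun ω => u (ω i) * u (ω j)) =
      if i = j then ∑ a, p a * u a ^ 2 else 0 := by
    intro i j
    split_ifs with hij
    · subst hij
      have := sampleExp_mul_of_invariant hp i (fun a => u a ^ 2) (fun _ => 1) (fun _ _ => rfl)
      rw [sampleExp_one hp, mul_one] at this
      rw [← this]
      exact Finset.sum_congr rfl fun ω _ => by ring
    · rw [sampleExp_mul_of_invariant hp i u (fun ω => u (ω j)), hu, zero_mul]
      intro ω a
      rw [Function.update_of_ne (Ne.symm hij)]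
  simp only [h1]
  rw [sampleExp_sum]
  simp only [sampleExp_sum, h2]
  simp

/-- Non-negativity of the variance of `|G|`. -/
theorem sampleExp_abs_le (hp0 : ∀ a, 0 ≤ p a) (hp : ∑ a, p a = 1) (G : (Fin m → α) → ℝ) :
    sampleExp p m (fun ω => |G ω|) ≤ √(sampleExp p m fun ω => G ω ^ 2) := by
  apply Real.le_sqrt_of_sq_le
  set μ := sampleExp p m (fun ω => |G ω|)
  have h : 0 ≤ sampleExp p m (fun ω => (|G ω| - μ) ^ 2) :=
    Finset.sum_nonneg fun ω _ => mul_nonneg (Finset.prod_nonneg fun _ _ => hp0 _) (sq_nonneg _)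
  have e : ∀ ω, (|G ω| - μ) ^ 2 = G ω ^ 2 + ((-2 * μ) * |G ω| + μ ^ 2 * 1) := fun ω => by
    rw [sub_sq, sq_abs]; ring
  simp only [e] at h
  rw [sampleExp_add, sampleExp_add, sampleExp_const_mul, sampleExp_const_mul,
    sampleExp_one hp] at h
  change 0 ≤ _ + (-2 * μ * μ + _) at h
  nlinarith

/-- Markov's inequality. -/
theorem sampleExp_markov [DecidableEq α] (hp0 : ∀ a, 0 ≤ p a) (hp : ∑ a, p a = 1)
    (G : (Fin m → α) → ℝ)
    (hG : ∀ ω, 0 ≤ G ω) {e c : ℝ} (hc : 0 < c) (he : sampleExp p m G ≤ e) :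
    1 - e / c ≤ ∑ ω with G ω ≤ c, ∏ i, p (ω i) := by
  have h1 : ∑ ω : Fin m → α, ∏ i, p (ω i) = 1 := by
    simpa [sampleExp] using sampleExp_one (m := m) hp
  rw [← Finset.sum_filter_add_sum_filter_not _ (fun ω => G ω ≤ c)] at h1
  have h2 : ∑ ω with ¬ G ω ≤ c, ∏ i, p (ω i) ≤ e / c := by
    rw [le_div_iff₀ hc, Finset.sum_mul]
    refine le_trans ?_ he
    refine (Finset.sum_le_sum fun ω hω => ?_).trans (Finset.sum_le_sum_of_subset_of_nonneg
      (Finset.filter_subset _ _) fun ω _ _ =>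
        mul_nonneg (Finset.prod_nonneg fun _ _ => hp0 _) (hG ω))
    exact mul_le_mul_of_nonneg_left (not_le.1 (Finset.mem_filter.1 hω).2).le
      (Finset.prod_nonneg fun _ _ => hp0 _)
  linarith

end SampleExp

/-- The event that the first `m` samples form one of the sequences in `S`. -/
theorem infinitePi_real_first_samples {α : Type*} [Fintype α] [DecidableEq α] [MeasurableSpace α]
    [MeasurableSingletonClass α] (f : PMF α) (m : ℕ) (S : Finset (Fin m → α)) :
    (Measure.infinitePi fun _ : ℕ => f.toMeasure).real {ω | (fun i : Fin m => ω i) ∈ S} =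
      ∑ v ∈ S, ∏ i, (f (v i)).toReal := by
  have e : {ω : ℕ → α | (fun i : Fin m => ω i) ∈ S} =
      ⋃ v ∈ S, {ω : ℕ → α | ∀ i : Fin m, ω i = v i} := by
    ext ω
    simp only [Set.mem_ofPred_eq, Set.mem_iUnion, exists_prop]
    constructor
    · exact fun h => ⟨_, h, fun _ => rfl⟩
    · rintro ⟨v, hv, h⟩
      rwa [show (fun i : Fin m => ω i) = v from funext h]
  have hms : ∀ v : Fin m → α, MeasurableSet {ω : ℕ → α | ∀ i : Fin m, ω i = v i} := by
    intro v
    rw [Set.ofPred_forall]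
    exact MeasurableSet.iInter fun i => measurable_pi_apply _ (measurableSet_singleton _)
  rw [e, measureReal_biUnion_finset _ fun v _ => hms v]
  · refine Finset.sum_congr rfl fun v _ => ?_
    have e' : {ω : ℕ → α | ∀ i : Fin m, ω i = v i} = Set.pi (Finset.range m : Set ℕ)
        (fun j => if h : j < m then {v ⟨j, h⟩} else Set.univ) := by
      ext ω
      simp only [Set.mem_ofPred_eq, Set.mem_pi, Finset.coe_range, Set.mem_Iio]
      constructor
      · intro h j hj
        simp [hj, h ⟨j, hj⟩]
      · intro h i
        simpa using h i i.2
    rw [e', Measure.real, Measure.infinitePi_pi]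
    · rw [ENNReal.toReal_prod, ← Fin.prod_univ_eq_prod_range
        (fun j => (f.toMeasure (if h : j < m then {v ⟨j, h⟩} else Set.univ)).toReal)]
      refine Finset.prod_congr rfl fun i _ => ?_
      simp
    · intro j hj
      split_ifs
      · exact measurableSet_singleton _
      · exact MeasurableSet.univ
  · intro v _ v' _ hne
    refine Set.disjoint_left.2 fun ω h h' => hne (funext fun i => ?_)
    exact (h i).symm.trans (h' i)

/-! ### Fluctuations of the empirical distribution function -/

/-- Sum of `p` over the points before `n`. -/
def prefixSum (p : ℕ → ℝ) (n : ℕ) : ℝ := ∑ x ∈ Finset.range n, p x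

theorem prefixSum_succ (p : ℕ → ℝ) (n : ℕ) : prefixSum p (n + 1) = prefixSum p n + p n :=
  Finset.sum_range_succ _ _

theorem prefixSum_zero (p : ℕ → ℝ) : prefixSum p 0 = 0 := rfl

theorem prefixSum_monotone {p : ℕ → ℝ} (hp : ∀ x, 0 ≤ p x) : Monotone (prefixSum p) :=
  monotone_nat_of_le_succ fun n => by rw [prefixSum_succ]; linarith [hp n]

/-- Blocks of a walk with increments `d`, cut as soon as they move by `l` or more: the movement of
the current block, and the total movement of the completed ones. -/
noncomputable def blockWalk (l : ℝ) (d : ℕ → ℝ) : ℕ → ℝ × ℝ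
  | 0 => (0, 0)
  | n + 1 =>
    if l ≤ |(blockWalk l d n).1 + d n| then
      (0, (blockWalk l d n).2 + |(blockWalk l d n).1 + d n|)
    else ((blockWalk l d n).1 + d n, (blockWalk l d n).2)

theorem blockWalk_abs_lt {l : ℝ} (hl : 0 < l) (d : ℕ → ℝ) (n : ℕ) : |(blockWalk l d n).1| < l := by
  induction n with
  | zero => simpa [blockWalk] using hl
  | succ n _ =>
    rw [blockWalk]
    split_ifs with h
    · simpa using hl
    · exact not_le.1 h

theorem blockWalk_snd_monotone (l : ℝ) (d : ℕ → ℝ) : Monotone fun n => (blockWalk l d n).2 := by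
  refine monotone_nat_of_le_succ fun n => ?_
  change (blockWalk l d n).2 ≤ (blockWalk l d (n + 1)).2
  rw [blockWalk]
  split_ifs with h
  · simp
  · exact le_rfl

/-- A block closed with movement `v` has `l ≤ |v|`, so `l * |v| ≤ v ^ 2`: the amount added to the
second component is paid for by the square that is reset. For martingale increments the cross term
has mean zero, and the potential grows only by the variances. -/
theorem blockWalk_potential {l : ℝ} (d : ℕ → ℝ) (n : ℕ) :
    l * (blockWalk l d (n + 1)).2 + (blockWalk l d (n + 1)).1 ^ 2 ≤
      l * (blockWalk l d n).2 + (blockWalk l d n).1 ^ 2 +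
        (2 * ((blockWalk l d n).1 * d n) + d n ^ 2) := by
  rw [blockWalk]
  split_ifs with h
  · have := sq_abs ((blockWalk l d n).1 + d n)
    have := mul_le_mul_of_nonneg_right h (abs_nonneg ((blockWalk l d n).1 + d n))
    simp only []
    nlinarith
  · simp only []
    nlinarith

/-- The walk minus its current block is the signed sum of the completed blocks, which the second
component dominates; the unfinished blocks at the two ends account for `2 * l`. -/
theorem blockWalk_increment {l : ℝ} (hl : 0 < l) (d : ℕ → ℝ) {a b : ℕ} (hab : a ≤ b) :
    |prefixSum d b - prefixSum d a| ≤ 2 * l + ((blockWalk l d b).2 - (blockWalk l d a).2) := by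
  have key : |prefixSum d b - (blockWalk l d b).1 - prefixSum d a| ≤
      l + ((blockWalk l d b).2 - (blockWalk l d a).2) := by
    induction b, hab using Nat.le_induction with
    | base =>
      have := (blockWalk_abs_lt hl d a).le
      rw [sub_self, add_zero, sub_sub, add_comm, ← sub_sub, sub_self, zero_sub, abs_neg]
      exact this
    | succ b _ ih =>
      rw [prefixSum_succ, blockWalk]
      split_ifs with h
      · simp only [sub_zero]
        calc _ = |(prefixSum d b - (blockWalk l d b).1 - prefixSum d a) +
              ((blockWalk l d b).1 + d b)| := by ring_nf
          _ ≤ _ := (abs_add_le _ _).trans (by linarith)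
      · simp only []
        convert ih using 2
        ring
  have := (blockWalk_abs_lt hl d b).le
  calc _ = |(prefixSum d b - (blockWalk l d b).1 - prefixSum d a) + (blockWalk l d b).1| := by
        ring_nf
    _ ≤ _ := (abs_add_le _ _).trans (by linarith)

theorem blockWalk_congr {l : ℝ} {d d' : ℕ → ℝ} {n : ℕ} (h : ∀ x < n, d x = d' x) :
    blockWalk l d n = blockWalk l d' n := by
  induction n with
  | zero => rfl
  | succ n ih =>
    rw [blockWalk, blockWalk, ih fun x hx => h x (by omega), h n (by omega)]

/-- Probability of the point `x` among the points from `x` on. -/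
noncomputable def hazard (p : ℕ → ℝ) (x : ℕ) : ℝ := p x / (1 - prefixSum p x)

/-- The empirical distribution function: the fraction of the samples before `x`. -/
noncomputable def empCdf {m N : ℕ} (ω : Fin m → Fin N) (x : ℕ) : ℝ :=
  (∑ i, if (ω i : ℕ) < x then 1 else 0) / m

/-- Contribution of one sample to the compensated empirical process at `x`. -/
noncomputable def compTerm (p : ℕ → ℝ) (x w : ℕ) : ℝ :=
  (if w = x then 1 else 0) - hazard p x * (if x ≤ w then 1 else 0)

/-- Increment at `x` of the compensated empirical process. -/
noncomputable def compIncr {m N : ℕ} (p : ℕ → ℝ) (ω : Fin m → Fin N) (x : ℕ) : ℝ :=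
  (∑ i, compTerm p x (ω i)) / m

/-- A bound for the total fluctuation before `n` of the empirical distribution function. -/
noncomputable def fluctuation {m N : ℕ} (p : ℕ → ℝ) (l : ℝ) (ω : Fin m → Fin N) (n : ℕ) : ℝ :=
  (blockWalk l (compIncr p ω) n).2 +
    prefixSum (fun x => hazard p x * |empCdf ω x - prefixSum p x|) n

/-! ### Moment bounds for the compensated empirical process. -/

section Noise

variable {p : ℕ → ℝ} {N m : ℕ}

theorem prefixSum_le_one (hp0 : ∀ x, 0 ≤ p x) (hp : prefixSum p N = 1) {x : ℕ} (hx : x ≤ N) :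
    prefixSum p x ≤ 1 := hp ▸ prefixSum_monotone hp0 hx

theorem hazard_nonneg (hp0 : ∀ x, 0 ≤ p x) (hp : prefixSum p N = 1) {x : ℕ} (hx : x < N) :
    0 ≤ hazard p x :=
  div_nonneg (hp0 x) (by linarith [prefixSum_le_one hp0 hp hx.le])

theorem hazard_mul (hp0 : ∀ x, 0 ≤ p x) (hp : prefixSum p N = 1) {x : ℕ} (hx : x < N) :
    hazard p x * (1 - prefixSum p x) = p x := by
  rw [hazard]
  -- If no mass is left from `x` on, the hazard is a division by zero, but then `p x = 0` as well.
  by_cases h : 1 - prefixSum p x = 0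
  · have h1 := prefixSum_le_one hp0 hp (x := x + 1) hx
    rw [prefixSum_succ] at h1
    have := hp0 x
    rw [h, mul_zero]; linarith
  · exact div_mul_cancel₀ _ h

theorem sum_fin_lt (p : ℕ → ℝ) {x : ℕ} (hx : x ≤ N) :
    ∑ a : Fin N, p a * (if (a : ℕ) < x then 1 else 0) = prefixSum p x := by
  rw [Fin.sum_univ_eq_sum_range (fun a => p a * (if a < x then 1 else 0)) N]
  simp only [mul_ite, mul_one, mul_zero]
  rw [← Finset.sum_filter, prefixSum]
  congr 1
  ext a
  simp only [Finset.mem_filter, Finset.mem_range]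
  omega

theorem sum_fin_ge (hp : prefixSum p N = 1) {x : ℕ} (hx : x ≤ N) :
    ∑ a : Fin N, p a * (if x ≤ (a : ℕ) then 1 else 0) = 1 - prefixSum p x := by
  rw [show 1 - prefixSum p x = prefixSum p N - prefixSum p x by rw [hp], ← sum_fin_lt p hx,
    ← sum_fin_lt p le_rfl, ← Finset.sum_sub_distrib]
  refine Finset.sum_congr rfl fun a _ => ?_
  have := a.2
  by_cases h : x ≤ (a : ℕ)
  · simp [h, not_lt.2 h]
  · simp [h, not_le.1 h]

theorem sum_fin_eq (p : ℕ → ℝ) {x : ℕ} (hx : x < N) :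
    ∑ a : Fin N, p a * (if (a : ℕ) = x then 1 else 0) = p x := by
  rw [Fin.sum_univ_eq_sum_range (fun a => p a * (if a = x then 1 else 0)) N]
  simp [hx]

theorem sum_compTerm (hp0 : ∀ x, 0 ≤ p x) (hp : prefixSum p N = 1) {x : ℕ} (hx : x < N) :
    ∑ a : Fin N, p a * compTerm p x a = 0 := by
  have e : ∀ a : Fin N, p a * compTerm p x a = p a * (if (a : ℕ) = x then 1 else 0) -
      hazard p x * (p a * (if x ≤ (a : ℕ) then 1 else 0)) := fun a => by
    rw [compTerm]; ring
  simp only [e]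
  rw [Finset.sum_sub_distrib, ← Finset.mul_sum, sum_fin_eq p hx, sum_fin_ge hp hx.le,
    hazard_mul hp0 hp hx, sub_self]

/-- The square of the term is `1_{w = x}` minus the hazard times the term itself, minus the hazard
times `1_{w = x}`. The middle part is centred and the last one has the right sign. -/
theorem sum_compTerm_sq_le (hp0 : ∀ x, 0 ≤ p x) (hp : prefixSum p N = 1) {x : ℕ} (hx : x < N) :
    ∑ a : Fin N, p a * compTerm p x a ^ 2 ≤ p x := by
  have e : ∀ a : Fin N, p a * compTerm p x a ^ 2 =
      (p a * (if (a : ℕ) = x then 1 else 0) - hazard p x * (p a * compTerm p x a)) -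
      hazard p x * (p a * (if (a : ℕ) = x then 1 else 0)) := fun a => by
    rw [compTerm]
    by_cases h : (a : ℕ) = x
    · simp [h]; ring
    · by_cases h' : x ≤ (a : ℕ) <;> simp [h, h']; ring
  simp only [e]
  rw [Finset.sum_sub_distrib, Finset.sum_sub_distrib, ← Finset.mul_sum, ← Finset.mul_sum,
    sum_fin_eq p hx, sum_compTerm hp0 hp hx]
  nlinarith [mul_nonneg (hazard_nonneg hp0 hp hx) (hp0 x)]

theorem sum_fin_pmf (hp : prefixSum p N = 1) : ∑ a : Fin N, p a = 1 := by
  rw [← hp, prefixSum, Fin.sum_univ_eq_sum_range]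

/-- Doob decomposition of the error process: a martingale increment, and a drift that pulls the
error back at the hazard rate. -/
theorem empCdf_succ_sub (hm : 0 < m) (hp0 : ∀ x, 0 ≤ p x) (hp : prefixSum p N = 1)
    (ω : Fin m → Fin N) {x : ℕ} (hx : x < N) :
    empCdf ω (x + 1) - prefixSum p (x + 1) = empCdf ω x - prefixSum p x +
      (compIncr p ω x - hazard p x * (empCdf ω x - prefixSum p x)) := by
  have hm' : (m : ℝ) ≠ 0 := by positivity
  have e : compIncr p ω x = empCdf ω (x + 1) - empCdf ω x - hazard p x * (1 - empCdf ω x) := by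
    have h1 : 1 - empCdf ω x = (∑ i, (1 - if (ω i : ℕ) < x then (1 : ℝ) else 0)) / m := by
      rw [Finset.sum_sub_distrib, empCdf]
      simp [sub_div, hm']
    rw [h1, compIncr, empCdf, empCdf, ← sub_div, ← mul_div_assoc, ← sub_div,
      ← Finset.sum_sub_distrib, Finset.mul_sum, ← Finset.sum_sub_distrib]
    congr 1
    refine Finset.sum_congr rfl fun i _ => ?_
    rw [compTerm]
    rcases lt_trichotomy (ω i : ℕ) x with h | h | h
    · simp [h, h.ne, not_le.2 h, Nat.lt_succ_of_lt h]
    · simp [h]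
    · simp [h.le, h.ne', not_lt.2 h.le, not_lt.2 (Nat.succ_le_of_lt h)]
  have := hazard_mul hp0 hp hx
  rw [e, prefixSum_succ]
  linear_combination this

theorem fluctuation_monotone (hp0 : ∀ x, 0 ≤ p x) (hp : prefixSum p N = 1) (l : ℝ)
    (ω : Fin m → Fin N) {a b : ℕ} (hab : a ≤ b) (hb : b ≤ N) :
    fluctuation p l ω a ≤ fluctuation p l ω b := by
  refine add_le_add (blockWalk_snd_monotone _ _ hab) ?_
  exact Finset.sum_le_sum_of_subset_of_nonneg (by simpa using hab) fun x hx _ =>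
    mul_nonneg (hazard_nonneg hp0 hp (by have := Finset.mem_range.1 hx; omega)) (abs_nonneg _)

theorem fluctuation_zero (l : ℝ) (ω : Fin m → Fin N) : fluctuation p l ω 0 = 0 := by
  simp [fluctuation, blockWalk, prefixSum]

/-- The bound holds for all intervals and one monotone function at once, so summing it over disjoint
intervals telescopes. This takes the place of a uniform convergence theorem for unions of intervals.
-/
theorem empCdf_increment_le (hm : 0 < m) (hp0 : ∀ x, 0 ≤ p x) (hp : prefixSum p N = 1)
    {l : ℝ} (hl : 0 < l) (ω : Fin m → Fin N) {a b : ℕ} (hab : a ≤ b) (hb : b ≤ N) :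
    |(empCdf ω b - prefixSum p b) - (empCdf ω a - prefixSum p a)| ≤
      2 * l + (fluctuation p l ω b - fluctuation p l ω a) := by
  set drift := fun x => hazard p x * (empCdf ω x - prefixSum p x)
  have e : ∀ b, a ≤ b → b ≤ N → (empCdf ω b - prefixSum p b) - (empCdf ω a - prefixSum p a) =
      (prefixSum (compIncr p ω) b - prefixSum (compIncr p ω) a) -
        ∑ x ∈ Finset.Ico a b, drift x := by
    intro b hab
    induction b, hab using Nat.le_induction with
    | base => simp
    | succ b hab ih =>
      intro hb
      rw [empCdf_succ_sub hm hp0 hp ω (by omega), prefixSum_succ, Finset.sum_Ico_succ_top hab]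
      linear_combination ih (by omega)
  rw [e b hab hb]
  have h1 := blockWalk_increment hl (compIncr p ω) hab
  have h2 : |∑ x ∈ Finset.Ico a b, drift x| ≤
      prefixSum (fun x => hazard p x * |empCdf ω x - prefixSum p x|) b -
      prefixSum (fun x => hazard p x * |empCdf ω x - prefixSum p x|) a := by
    refine (Finset.abs_sum_le_sum_abs _ _).trans ?_
    rw [prefixSum, prefixSum, ← Finset.sum_Ico_eq_sub _ hab]
    refine Finset.sum_le_sum fun x hx => ?_
    rw [abs_mul, abs_of_nonneg (hazard_nonneg hp0 hp (by have := Finset.mem_Ico.1 hx; omega))]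
  rw [fluctuation, fluctuation]
  exact (abs_sub _ _).trans (by linarith)

/-- Orthogonality of martingale increments, one sample at a time. A sample before `x` contributes
nothing at `x`; any other sample influences the walk up to `x` only through not lying before `x`, so
it may be replaced by `x` there. Its centred term then splits off. -/
theorem sampleExp_blockWalk_mul (hp0 : ∀ x, 0 ≤ p x) (hp : prefixSum p N = 1) (l : ℝ)
    {x : ℕ} (hx : x < N) :
    sampleExp (fun a : Fin N => p a) m
      (fun ω => (blockWalk l (compIncr p ω) x).1 * compIncr p ω x) = 0 := by
  have e : ∀ ω : Fin m → Fin N, (blockWalk l (compIncr p ω) x).1 * compIncr p ω x =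
      ∑ i, (m : ℝ)⁻¹ * (compTerm p x (ω i) *
        (blockWalk l (compIncr p (Function.update ω i ⟨x, hx⟩)) x).1) := by
    intro ω
    rw [compIncr, div_eq_inv_mul, Finset.mul_sum, Finset.mul_sum]
    refine Finset.sum_congr rfl fun i _ => ?_
    by_cases h : (ω i : ℕ) < x
    · simp [compTerm, h.ne, not_le.2 h]
    · have : blockWalk l (compIncr p ω) x =
          blockWalk l (compIncr p (Function.update ω i ⟨x, hx⟩)) x := by
        refine blockWalk_congr fun y hy => ?_
        rw [compIncr, compIncr]
        congr 1
        refine Finset.sum_congr rfl fun j _ => ?_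
        by_cases hj : j = i
        · subst hj
          rw [Function.update_self, compTerm, compTerm]
          have h1 : (ω j : ℕ) ≠ y := by omega
          have h2 : y ≤ (ω j : ℕ) := by omega
          simp [h1, h2, hy.le, hy.ne']
        · rw [Function.update_of_ne hj]
      rw [this]; ring
  simp only [e]
  rw [sampleExp_sum]
  refine Finset.sum_eq_zero fun i _ => ?_
  rw [sampleExp_const_mul, sampleExp_mul_of_invariant (sum_fin_pmf hp) i
    (fun a : Fin N => compTerm p x a)
    (fun ω => (blockWalk l (compIncr p (Function.update ω i ⟨x, hx⟩)) x).1),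
    sum_compTerm hp0 hp hx]
  · ring
  · intro ω a
    rw [Function.update_idem]

theorem sampleExp_compIncr_sq_le (hm : 0 < m) (hp0 : ∀ x, 0 ≤ p x) (hp : prefixSum p N = 1)
    {x : ℕ} (hx : x < N) :
    sampleExp (fun a : Fin N => p a) m (fun ω => compIncr p ω x ^ 2) ≤ p x / m := by
  have hm' : (m : ℝ) ≠ 0 := by positivity
  have e : ∀ ω : Fin m → Fin N, compIncr p ω x ^ 2 =
      ((m : ℝ) ^ 2)⁻¹ * (∑ i, compTerm p x (ω i)) ^ 2 := fun ω => by
    rw [compIncr, div_pow, div_eq_inv_mul]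
  simp only [e]
  rw [sampleExp_const_mul, sampleExp_sum_sq (sum_fin_pmf hp) (fun a : Fin N => compTerm p x a)
    (sum_compTerm hp0 hp hx)]
  have := sum_compTerm_sq_le hp0 hp hx
  calc _ = (∑ a : Fin N, p a * compTerm p x a ^ 2) / m := by field_simp
    _ ≤ _ := by gcongr

/-- The expected potential grows by at most `p x / m` at `x`, hence by at most `1 / m` in all;
dividing by `l` bounds the completed blocks. -/
theorem sampleExp_blockWalk_le (hm : 0 < m) (hp0 : ∀ x, 0 ≤ p x) (hp : prefixSum p N = 1)
    {l : ℝ} (hl : 0 < l) :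
    sampleExp (fun a : Fin N => p a) m (fun ω => (blockWalk l (compIncr p ω) N).2) ≤
      1 / (l * m) := by
  obtain ⟨b, hb⟩ : ∃ b : ℕ → (Fin m → Fin N) → ℝ,
    b = fun n ω => (blockWalk l (compIncr p ω) n).1 := ⟨_, rfl⟩
  obtain ⟨w, hw⟩ : ∃ w : ℕ → (Fin m → Fin N) → ℝ,
    w = fun n ω => (blockWalk l (compIncr p ω) n).2 := ⟨_, rfl⟩
  have pot : ∀ n ω, l * w (n + 1) ω + b (n + 1) ω ^ 2 ≤ (l * w n ω + b n ω ^ 2) +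
      (2 * (b n ω * compIncr p ω n) + compIncr p ω n ^ 2) := by
    intro n ω
    rw [hb, hw]
    exact blockWalk_potential (compIncr p ω) n
  have hmul : ∀ n < N, sampleExp (fun a : Fin N => p a) m
      (fun ω => b n ω * compIncr p ω n) = 0 := by
    intro n hn
    rw [hb]
    exact sampleExp_blockWalk_mul hp0 hp l hn
  have hb0 : ∀ ω, b 0 ω = 0 := fun ω => by rw [hb]; rfl
  have hw0 : ∀ ω, w 0 ω = 0 := fun ω => by rw [hw]; rfl
  change sampleExp (fun a : Fin N => p a) m (fun ω => (fun n ω =>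
    (blockWalk l (compIncr p ω) n).2) N ω) ≤ _
  rw [← hw]
  clear hb hw
  have key : ∀ n ≤ N, sampleExp (fun a : Fin N => p a) m (fun ω => l * w n ω + b n ω ^ 2) ≤
      prefixSum p n / m := by
    intro n
    induction n with
    | zero => intro _; simp [hb0, hw0, prefixSum, sampleExp]
    | succ n ih =>
      intro hn
      refine (sampleExp_mono (fun a : Fin N => hp0 a) (pot n)).trans ?_
      rw [sampleExp_add (fun ω => l * w n ω + b n ω ^ 2),
        sampleExp_add (fun ω => 2 * (b n ω * compIncr p ω n)), sampleExp_const_mul, hmul n (by omega), prefixSum_succ,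
        add_div]
      have := ih (by omega)
      have := sampleExp_compIncr_sq_le hm hp0 hp (x := n) (by omega)
      linarith
  have h1 := key N le_rfl
  have h2 : sampleExp (fun a : Fin N => p a) m (fun ω => l * w N ω) ≤ prefixSum p N / m :=
    (sampleExp_mono (fun a : Fin N => hp0 a) fun ω =>
      le_add_of_nonneg_right (sq_nonneg _)).trans h1
  rw [sampleExp_const_mul, hp] at h2
  have hm' : (0 : ℝ) < m := by exact_mod_cast hm
  rw [le_div_iff₀ (by positivity)]
  rw [le_div_iff₀ hm'] at h2
  linarith

/-- The variance is `F * (1 - F) / m` with `F = prefixSum p x`. The factor `1 - F` is kept because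
it has to offset the hazard, whose denominator it is. -/
theorem sampleExp_abs_empCdf_sub_le (hm : 0 < m) (hp0 : ∀ x, 0 ≤ p x) (hp : prefixSum p N = 1)
    {x : ℕ} (hx : x ≤ N) :
    sampleExp (fun a : Fin N => p a) m (fun ω => |empCdf ω x - prefixSum p x|) ≤
      √(1 - prefixSum p x) / √m := by
  have hm' : (m : ℝ) ≠ 0 := by positivity
  refine (sampleExp_abs_le (p := fun a : Fin N => p a) (fun a => hp0 a) (sum_fin_pmf hp) _).trans ?_
  rw [← Real.sqrt_div' _ (Nat.cast_nonneg m)]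
  apply Real.sqrt_le_sqrt
  set F := prefixSum p x
  set u : Fin N → ℝ := fun a => (if (a : ℕ) < x then 1 else 0) - F
  have e : ∀ ω : Fin m → Fin N, (empCdf ω x - F) ^ 2 =
      ((m : ℝ) ^ 2)⁻¹ * (∑ i, u (ω i)) ^ 2 := fun ω => by
    simp only [u]
    rw [Finset.sum_sub_distrib, empCdf]
    simp only [Finset.sum_const, Finset.card_univ, Fintype.card_fin, nsmul_eq_mul]
    field_simp
  have hu : ∑ a : Fin N, p a * u a = 0 := by
    simp only [u, mul_sub]
    rw [Finset.sum_sub_distrib, sum_fin_lt p hx, ← Finset.sum_mul, sum_fin_pmf hp]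
    ring
  have hu2 : ∑ a : Fin N, p a * u a ^ 2 = F - F ^ 2 := by
    have e2 : ∀ a : Fin N, p a * u a ^ 2 =
        p a * (if (a : ℕ) < x then 1 else 0) * (1 - 2 * F) + p a * F ^ 2 := fun a => by
      simp only [u]
      split_ifs <;> ring
    simp only [e2]
    rw [Finset.sum_add_distrib, ← Finset.sum_mul, ← Finset.sum_mul, sum_fin_lt p hx,
      sum_fin_pmf hp]
    ring
  simp only [e]
  rw [sampleExp_const_mul, sampleExp_sum_sq (sum_fin_pmf hp) u hu, hu2]
  calc _ = (F - F ^ 2) / m := by field_simp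
    _ ≤ _ := div_le_div_of_nonneg_right (by nlinarith [sq_nonneg (1 - F)]) (by positivity)

theorem sampleExp_fluctuation_le (hm : 0 < m) (hp0 : ∀ x, 0 ≤ p x) (hp : prefixSum p N = 1)
    {l : ℝ} (hl : 0 < l) :
    sampleExp (fun a : Fin N => p a) m (fun ω => fluctuation p l ω N) ≤
      1 / (l * m) + 2 / √m := by
  simp only [fluctuation]
  rw [sampleExp_add _ (fun ω : Fin m → Fin N =>
    prefixSum (fun x => hazard p x * |empCdf ω x - prefixSum p x|) N)]
  refine add_le_add (sampleExp_blockWalk_le hm hp0 hp hl) ?_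
  have hs : 0 < √(m : ℝ) := Real.sqrt_pos.2 (by exact_mod_cast hm)
  have key : ∀ n ≤ N, sampleExp (fun a : Fin N => p a) m (fun ω =>
      prefixSum (fun x => hazard p x * |empCdf ω x - prefixSum p x|) n) ≤
      2 * (1 - √(1 - prefixSum p n)) / √m := by
    intro n
    induction n with
    | zero => intro _; simp [prefixSum, sampleExp]
    | succ n ih =>
      intro hn
      simp only [prefixSum_succ _ n]
      rw [sampleExp_add _ (fun ω : Fin m → Fin N =>
        hazard p n * |empCdf ω n - prefixSum p n|), sampleExp_const_mul]
      have h0 := hazard_nonneg hp0 hp (x := n) (by omega)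
      have h1 := ih (by omega)
      have h2 := mul_le_mul_of_nonneg_left
        (sampleExp_abs_empCdf_sub_le hm hp0 hp (x := n) (by omega)) h0
      -- With `s`, `s'` the square roots of the tails at `n` and `n + 1`, the hazard times `s ^ 2`
      -- is `p n = (s - s') * (s + s')`, at most `2 * s * (s - s')`. Dividing by `s` makes the drift
      -- telescope.
      have h3 : hazard p n * √(1 - prefixSum p n) ≤
          2 * (√(1 - prefixSum p n) - √(1 - (prefixSum p n + p n))) := by
        have hF := prefixSum_le_one hp0 hp (x := n + 1) (by omega)
        rw [prefixSum_succ] at hF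
        have hF' : 0 ≤ 1 - prefixSum p n := by linarith [hp0 n]
        have hh := hazard_mul hp0 hp (x := n) (by omega)
        set s := √(1 - prefixSum p n) with hs
        set s' := √(1 - (prefixSum p n + p n)) with hs'
        have e1 : s ^ 2 = 1 - prefixSum p n := Real.sq_sqrt hF'
        have e2 : s' ^ 2 = 1 - (prefixSum p n + p n) := Real.sq_sqrt (by linarith)
        have hle : s' ≤ s := Real.sqrt_le_sqrt (by linarith [hp0 n])
        have hs0 : 0 ≤ s := Real.sqrt_nonneg _
        rcases hs0.eq_or_lt with h | h
        · rw [← h]; rw [← h] at hle; nlinarith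
        · have : hazard p n * s * s = (s - s') * (s + s') := by
            rw [mul_assoc, ← sq, e1, hh]
            nlinarith
          nlinarith
      have h4 : hazard p n * (√(1 - prefixSum p n) / √m) ≤
          2 * (√(1 - prefixSum p n) - √(1 - (prefixSum p n + p n))) / √m := by
        rw [← mul_div_assoc]; gcongr
      calc _ ≤ 2 * (1 - √(1 - prefixSum p n)) / √m +
            2 * (√(1 - prefixSum p n) - √(1 - (prefixSum p n + p n))) / √m := by linarith
        _ = _ := by ring
  have := key N le_rfl
  rw [hp] at this
  simpa using this

end Noise

/-! ### Greedy piecewise linear fits of a distribution function -/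

/-- The line of slope `σ` through the graph of `Z` at `a` is within `τ` of the graph on `[a, b]`. -/
def Fits (Z : ℕ → ℝ) (τ : ℝ) (a b : ℕ) (σ : ℝ) : Prop :=
  -- `0 ≤ σ` lets flat stretches of `Z` be tested at their ends only, and `σ ≤ 1` keeps the set of
  -- slopes a compact interval. The comparison histograms have values in `[0, 1]`, so their slopes
  -- are not excluded.
  0 ≤ σ ∧ σ ≤ 1 ∧ ∀ n, a ≤ n → n ≤ b → |Z n - Z a - σ * ((n : ℝ) - a)| ≤ τ

/-- `GreedyFit Z τ o a`: the list `o` describes a piecewise constant function on `[0, a)` that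
comes from consecutive blocks, each a union of two intervals that admit a fit, while no slope fits
the whole block. -/
inductive GreedyFit (Z : ℕ → ℝ) (τ : ℝ) : List (ℕ × ℝ) → ℕ → Prop where
  | nil : GreedyFit Z τ [] 0
  | step {o : List (ℕ × ℝ)} {a b z : ℕ} {σ σ' : ℝ} :
      GreedyFit Z τ o a → a < b → b < z → (∀ s, ¬ Fits Z τ a z s) → Fits Z τ a b σ →
      Fits Z τ b z σ' → GreedyFit Z τ (o ++ [(b - 1, σ), (z - 1, σ')]) z

/-- Value at `x` of the piecewise constant function described by `o`. -/
noncomputable def pieceValue (o : List (ℕ × ℝ)) (x : ℕ) : ℝ :=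
  match o.find? (fun e => decide (x ≤ e.1)) with
  | some e => e.2
  | none => 0

theorem pieceValue_append_of_exists {o : List (ℕ × ℝ)} {x : ℕ} (h : ∃ e ∈ o, x ≤ e.1)
    (l : List (ℕ × ℝ)) : pieceValue (o ++ l) x = pieceValue o x := by
  have : (o.find? (fun e => decide (x ≤ e.1))).isSome := by
    rw [List.find?_isSome]
    simpa using h
  rw [pieceValue, pieceValue, List.find?_append, Option.or_of_isSome this]

theorem pieceValue_append_of_forall {o : List (ℕ × ℝ)} {x : ℕ} (h : ∀ e ∈ o, e.1 < x)
    (l : List (ℕ × ℝ)) : pieceValue (o ++ l) x = pieceValue l x := by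
  have : o.find? (fun e => decide (x ≤ e.1)) = none := by
    rw [List.find?_eq_none]
    intro e he
    simpa using h e he
  rw [pieceValue, pieceValue, List.find?_append, this, Option.none_or]

theorem pieceValue_cons_of_le {e : ℕ × ℝ} {x : ℕ} (h : x ≤ e.1) (l : List (ℕ × ℝ)) :
    pieceValue (e :: l) x = e.2 := by
  simp [pieceValue, h]

theorem pieceValue_cons_of_lt {e : ℕ × ℝ} {x : ℕ} (h : e.1 < x) (l : List (ℕ × ℝ)) :
    pieceValue (e :: l) x = pieceValue l x := by
  simp [pieceValue, not_le.2 h]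

theorem GreedyFit.lt {Z : ℕ → ℝ} {τ : ℝ} {o : List (ℕ × ℝ)} {a : ℕ} (h : GreedyFit Z τ o a) :
    ∀ e ∈ o, e.1 < a := by
  induction h with
  | nil => simp
  | step h hab hbz _ _ _ ih =>
    intro e he
    simp only [List.mem_append, List.mem_cons, List.not_mem_nil, or_false] at he
    rcases he with he | rfl | rfl
    · have := ih e he; omega
    · simp only; omega
    · simp only; omega

theorem GreedyFit.exists_le {Z : ℕ → ℝ} {τ : ℝ} {o : List (ℕ × ℝ)} {a : ℕ}
    (h : GreedyFit Z τ o a) {x : ℕ} (hx : x < a) : ∃ e ∈ o, x ≤ e.1 := by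
  cases h with
  | nil => omega
  | step h hab hbz _ _ _ =>
    exact ⟨(a - 1, _), List.mem_append_right _ (by
      simp only [List.mem_cons]; exact Or.inr (Or.inl rfl)), by simp only; omega⟩

open Classical in
/-- Number of points before `n` where `g` differs from its value at the preceding point. -/
noncomputable def jumpCount (g : ℕ → ℝ) (n : ℕ) : ℕ :=
  -- Since `0 - 1 = 0` in `ℕ`, the point `0` never counts as a jump.
  ((Finset.range n).filter fun x => g x ≠ g (x - 1)).card

theorem jumpCount_succ_of_eq {g : ℕ → ℝ} {n : ℕ} (h : g n = g (n - 1)) :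
    jumpCount g (n + 1) = jumpCount g n := by
  classical
  rw [jumpCount, Finset.range_add_one, Finset.filter_insert, if_neg (not_not.2 h), jumpCount]

theorem jumpCount_succ_of_ne {g : ℕ → ℝ} {n : ℕ} (h : g n ≠ g (n - 1)) :
    jumpCount g (n + 1) = jumpCount g n + 1 := by
  classical
  rw [jumpCount, Finset.range_add_one, Finset.filter_insert, if_pos h,
    Finset.card_insert_of_notMem (by simp), jumpCount]

theorem jumpCount_monotone (g : ℕ → ℝ) : Monotone (jumpCount g) :=
  monotone_nat_of_le_succ fun n => by
    by_cases h : g n = g (n - 1)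
    · rw [jumpCount_succ_of_eq h]
    · rw [jumpCount_succ_of_ne h]; omega

theorem prefixSum_sub_of_const {g : ℕ → ℝ} {a b : ℕ} {γ : ℝ} (hab : a ≤ b)
    (h : ∀ x, a ≤ x → x < b → g x = γ) : prefixSum g b - prefixSum g a = γ * ((b : ℝ) - a) := by
  rw [prefixSum, prefixSum, ← Finset.sum_Ico_eq_sub _ hab,
    Finset.sum_congr rfl fun x hx => h x (Finset.mem_Ico.1 hx).1 (Finset.mem_Ico.1 hx).2]
  simp [Nat.cast_sub hab, mul_comm]

theorem eq_of_jumpCount_eq {g : ℕ → ℝ} {a b : ℕ} (h : jumpCount g b = jumpCount g a) :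
    ∀ x, a ≤ x → x < b → g x = g a := by
  intro x hax
  induction x, hax using Nat.le_induction with
  | base => exact fun _ => rfl
  | succ x hax ih =>
    intro hx
    rw [← ih (by omega)]
    by_contra hne
    have h1 := jumpCount_succ_of_ne (g := g) (n := x + 1) hne
    have h2 := jumpCount_monotone g hax
    have h3 := jumpCount_monotone g (show x ≤ x + 1 by omega)
    have h4 := jumpCount_monotone g (show x + 1 + 1 ≤ b by omega)
    omega

/-! ### Error of the greedy fit against an arbitrary histogram `g` with noise function `W`. -/

section FitError

variable {Z g W : ℕ → ℝ} {l τ : ℝ} {N : ℕ}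

/-- On a stretch where `g` is constant the error is the difference of two increments: the line's
differs from that of `Z` by at most `2 * τ`, and that of `Z` from that of `g` by the noise. -/
theorem Fits.sum_abs_sub_le_of_const
    (hZ : ∀ a b, a ≤ b → b ≤ N →
      |(Z b - Z a) - (prefixSum g b - prefixSum g a)| ≤ 2 * l + (W b - W a))
    {a b : ℕ} {σ : ℝ} (h : Fits Z τ a b σ) {c : ℕ} (hac : a ≤ c) (hcb : c ≤ b) (hb : b ≤ N) {γ : ℝ}
    (hg : ∀ x, c ≤ x → x < b → g x = γ) :
    ∑ x ∈ Finset.Ico c b, |σ - g x| ≤ (2 * τ + 2 * l) + (W b - W c) := by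
  have h1 := h.2.2 c hac hcb
  have h2 := h.2.2 b (hac.trans hcb) le_rfl
  have h3 := hZ c b hcb hb
  have h4 := prefixSum_sub_of_const hcb hg
  rw [Finset.sum_congr rfl fun x hx => by
    rw [hg x (Finset.mem_Ico.1 hx).1 (Finset.mem_Ico.1 hx).2]]
  have hcb' : (0 : ℝ) ≤ (b : ℝ) - c := by
    have : (c : ℝ) ≤ b := by exact_mod_cast hcb
    linarith
  have e : ∑ x ∈ Finset.Ico c b, |σ - γ| = |(σ - γ) * ((b : ℝ) - c)| := by
    rw [abs_mul, abs_of_nonneg hcb']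
    simp [Nat.cast_sub hcb, mul_comm]
  rw [e]
  rw [abs_le] at h1 h2 h3 ⊢
  constructor <;> nlinarith

/-- The constant stretches of `g` on `[a, b)` number at most one more than its jumps there; each
pays `2 * τ + 2 * l`, and the noise telescopes. -/
theorem Fits.sum_abs_sub_le
    (hZ : ∀ a b, a ≤ b → b ≤ N →
      |(Z b - Z a) - (prefixSum g b - prefixSum g a)| ≤ 2 * l + (W b - W a))
    {a b : ℕ} {σ : ℝ} (hab : a ≤ b) (hb : b ≤ N) (h : Fits Z τ a b σ) :
    ∑ x ∈ Finset.Ico a b, |σ - g x| ≤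
      (1 + ((jumpCount g b : ℝ) - jumpCount g a)) * (2 * τ + 2 * l) + (W b - W a) := by
  have key : ∀ c, a ≤ c → c ≤ b → ∃ d, a ≤ d ∧ d ≤ c ∧ (∀ x, d ≤ x → x < c → g x = g d) ∧
      ∑ x ∈ Finset.Ico a d, |σ - g x| ≤
        ((jumpCount g c : ℝ) - jumpCount g a) * (2 * τ + 2 * l) + (W d - W a) := by
    intro c hac
    induction c, hac using Nat.le_induction with
    | base => exact fun _ => ⟨a, le_rfl, le_rfl, fun x _ _ => by omega, by simp⟩
    | succ c hac ih =>
      intro hcb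
      obtain ⟨d, had, hdc, hconst, hsum⟩ := ih (by omega)
      by_cases hj : g c = g (c - 1)
      · refine ⟨d, had, by omega, fun x hdx hxc => ?_, by rwa [jumpCount_succ_of_eq hj]⟩
        rcases Nat.lt_succ_iff_lt_or_eq.1 hxc with hx | rfl
        · exact hconst x hdx hx
        · rcases hdx.eq_or_lt with rfl | hlt
          · rfl
          · rw [hj]; exact hconst _ (by omega) (by omega)
      · refine ⟨c, hac, by omega, fun x _ _ => by rw [show x = c by omega], ?_⟩
        have hf : Fits Z τ a c σ := ⟨h.1, h.2.1, fun n h1 h2 => h.2.2 n h1 (by omega)⟩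
        have := hf.sum_abs_sub_le_of_const hZ had hdc (by omega) hconst
        rw [← Finset.sum_Ico_consecutive _ had hdc, jumpCount_succ_of_ne hj]
        push_cast
        linarith
  obtain ⟨d, had, hdb, hconst, hsum⟩ := key b hab le_rfl
  have := h.sum_abs_sub_le_of_const hZ had hdb hb hconst
  rw [← Finset.sum_Ico_consecutive _ had hdb]
  linarith

/-- With `τ = 4 * l` a constant stretch costs `10 * l`, so a block of two pieces costs `20 * l` plus
`10 * l` per jump plus its noise. Ten times `hcharge` absorbs the `20 * l`, whence the factors `30`
and `11`. -/
theorem GreedyFit.sum_abs_sub_le (hl : 0 < l) (hW : ∀ a b, a ≤ b → b ≤ N → W a ≤ W b)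
    (hW0 : W 0 = 0) (hg : ∀ x < N, 0 ≤ g x ∧ g x ≤ 1)
    (hZ : ∀ a b, a ≤ b → b ≤ N →
      |(Z b - Z a) - (prefixSum g b - prefixSum g a)| ≤ 2 * l + (W b - W a))
    {o : List (ℕ × ℝ)} {a : ℕ} (h : GreedyFit Z (4 * l) o a) (ha : a ≤ N) :
    ∑ x ∈ Finset.range a, |pieceValue o x - g x| ≤ 30 * l * jumpCount g a + 11 * W a := by
  induction h with
  | nil => simp [jumpCount, hW0]
  | @step o a b z σ σ' h hab hbz hno hf hf' ih =>
    have ih := ih (by omega)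
    have e1 : ∑ x ∈ Finset.range a, |pieceValue (o ++ [(b - 1, σ), (z - 1, σ')]) x - g x| =
        ∑ x ∈ Finset.range a, |pieceValue o x - g x| :=
      Finset.sum_congr rfl fun x hx => by
        rw [pieceValue_append_of_exists (h.exists_le (Finset.mem_range.1 hx))]
    have e2 : ∑ x ∈ Finset.Ico a b, |pieceValue (o ++ [(b - 1, σ), (z - 1, σ')]) x - g x| =
        ∑ x ∈ Finset.Ico a b, |σ - g x| :=
      Finset.sum_congr rfl fun x hx => by
        have := Finset.mem_Ico.1 hx
        rw [pieceValue_append_of_forall fun e he => (h.lt e he).trans_le this.1,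
          pieceValue_cons_of_le (by simp only; omega)]
    have e3 : ∑ x ∈ Finset.Ico b z, |pieceValue (o ++ [(b - 1, σ), (z - 1, σ')]) x - g x| =
        ∑ x ∈ Finset.Ico b z, |σ' - g x| :=
      Finset.sum_congr rfl fun x hx => by
        have := Finset.mem_Ico.1 hx
        rw [pieceValue_append_of_forall fun e he => (h.lt e he).trans_le (by omega),
          pieceValue_cons_of_lt (by simp only; omega),
          pieceValue_cons_of_le (by simp only; omega)]
    rw [Finset.range_eq_Ico] at e1 ⊢
    rw [← Finset.sum_Ico_consecutive _ (Nat.zero_le a) (by omega : a ≤ z),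
      ← Finset.sum_Ico_consecutive _ hab.le hbz.le, e1, e2, e3, ← Finset.range_eq_Ico]
    have s1 := hf.sum_abs_sub_le hZ hab.le (by omega)
    have s2 := hf'.sum_abs_sub_le hZ hbz.le ha
    have hWz := hW a z (by omega) ha
    have hj := jumpCount_monotone g (show a ≤ z by omega)
    -- If `g` is constant on the block, its value is a slope that does not fit, so `Z` leaves that
    -- line by more than `4 * l`; of this, `2 * l` is allowed for free and the rest is noise.
    have hcharge : 2 * l ≤ 2 * l * ((jumpCount g z : ℝ) - jumpCount g a) + (W z - W a) := by
      rcases hj.eq_or_lt with hj | hj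
      · have hconst := eq_of_jumpCount_eq hj.symm
        have := hno (g a)
        rw [Fits] at this
        push Not at this
        obtain ⟨n, han, hnz, hn⟩ := this (hg a (by omega)).1 (hg a (by omega)).2
        have h1 := hZ a n han (by omega)
        rw [prefixSum_sub_of_const han fun x h1 h2 => hconst x h1 (by omega)] at h1
        have h2 := hW n z hnz ha
        rw [hj]
        linarith
      · have : (jumpCount g a : ℝ) + 1 ≤ jumpCount g z := by exact_mod_cast hj
        nlinarith
    linarith

theorem GreedyFit.sum_abs_sub_le_of_fits (hl : 0 < l)
    (hW : ∀ a b, a ≤ b → b ≤ N → W a ≤ W b) (hW0 : W 0 = 0)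
    (hg : ∀ x < N, 0 ≤ g x ∧ g x ≤ 1)
    (hZ : ∀ a b, a ≤ b → b ≤ N →
      |(Z b - Z a) - (prefixSum g b - prefixSum g a)| ≤ 2 * l + (W b - W a))
    {o : List (ℕ × ℝ)} {a : ℕ} (h : GreedyFit Z (4 * l) o a) (ha : a ≤ N) {σ : ℝ}
    (hf : Fits Z (4 * l) a N σ) :
    ∑ x ∈ Finset.range N, |pieceValue (o ++ [(N - 1, σ)]) x - g x| ≤
      30 * l * jumpCount g N + 10 * l + 11 * W N := by
  have e1 : ∑ x ∈ Finset.range a, |pieceValue (o ++ [(N - 1, σ)]) x - g x| =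
      ∑ x ∈ Finset.range a, |pieceValue o x - g x| :=
    Finset.sum_congr rfl fun x hx => by
      rw [pieceValue_append_of_exists (h.exists_le (Finset.mem_range.1 hx))]
  have e2 : ∑ x ∈ Finset.Ico a N, |pieceValue (o ++ [(N - 1, σ)]) x - g x| =
      ∑ x ∈ Finset.Ico a N, |σ - g x| :=
    Finset.sum_congr rfl fun x hx => by
      have := Finset.mem_Ico.1 hx
      rw [pieceValue_append_of_forall fun e he => (h.lt e he).trans_le this.1,
        pieceValue_cons_of_le (by simp only; omega)]
  rw [Finset.range_eq_Ico] at e1 ⊢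
  rw [← Finset.sum_Ico_consecutive _ (Nat.zero_le a) ha, e1, e2, ← Finset.range_eq_Ico]
  have s1 := hf.sum_abs_sub_le hZ ha le_rfl
  have s2 := h.sum_abs_sub_le hl hW hW0 hg hZ ha
  have s3 := hW a N ha le_rfl
  have hj : (jumpCount g a : ℝ) ≤ jumpCount g N := by exact_mod_cast jumpCount_monotone g ha
  nlinarith

end FitError

/-! ### Approximation of mixtures of modal distributions by histograms -/

/-- Index of the interval `[(1 + δ) ^ i, (1 + δ) ^ (i + 1))` that contains `y + 1`. -/
noncomputable def geomLevel (δ : ℝ) (y : ℕ) : ℕ := ⌊Real.log (y + 1) / Real.log (1 + δ)⌋₊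

/-- The first point on the same geometric level as `y`. -/
noncomputable def geomRound (δ : ℝ) (y : ℕ) : ℕ := sInf {z | geomLevel δ z = geomLevel δ y}

/-! ### Birgé's rounding of a non-increasing function. -/

section Geom

variable {δ : ℝ}

theorem geomLevel_monotone (hδ : 0 < δ) : Monotone (geomLevel δ) := fun y z h => by
  have h0 : 0 < Real.log (1 + δ) := Real.log_pos (by linarith)
  have h1 : (y : ℝ) ≤ z := by exact_mod_cast h
  rw [geomLevel, geomLevel]
  gcongr

theorem geomRound_le (δ : ℝ) (y : ℕ) : geomRound δ y ≤ y := Nat.sInf_le rfl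

theorem geomLevel_geomRound (δ : ℝ) (y : ℕ) : geomLevel δ (geomRound δ y) = geomLevel δ y :=
  Nat.sInf_mem (s := {z | geomLevel δ z = geomLevel δ y}) ⟨y, rfl⟩

theorem geomRound_congr {y z : ℕ} (h : geomLevel δ y = geomLevel δ z) :
    geomRound δ y = geomRound δ z := by
  rw [geomRound, geomRound, h]

/-- Equal levels give `z + 1 < (1 + δ) * (y + 1)`. For `y ≥ 1` this yields the bound through `y + 1
≤ 2 * y`; for `y = 0` it forces `z = 0`. -/
theorem sub_le_of_geomLevel_eq (hδ : 0 < δ) (hδ1 : δ ≤ 1) {y z : ℕ} (hyz : y ≤ z)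
    (h : geomLevel δ y = geomLevel δ z) : (z : ℝ) - y ≤ 2 * δ * y := by
  have h0 : 0 < Real.log (1 + δ) := Real.log_pos (by linarith)
  have h1 : Real.log (z + 1) / Real.log (1 + δ) < geomLevel δ z + 1 := Nat.lt_floor_add_one _
  have h2 : (geomLevel δ y : ℝ) ≤ Real.log (y + 1) / Real.log (1 + δ) :=
    Nat.floor_le (div_nonneg (Real.log_nonneg (by simp)) h0.le)
  rw [← h] at h1
  have h3 : Real.log (z + 1) / Real.log (1 + δ) < Real.log (y + 1) / Real.log (1 + δ) + 1 := by
    linarith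
  rw [div_add_one h0.ne', div_lt_div_iff_of_pos_right h0,
    ← Real.log_mul (by positivity) (by positivity)] at h3
  have h4 := (Real.log_lt_log_iff (by positivity) (by positivity)).1 h3
  rcases Nat.eq_zero_or_pos y with rfl | hy
  · have : (z : ℝ) < 1 := by push_cast at h4; linarith
    have : z = 0 := by
      have : z < 1 := by exact_mod_cast this
      omega
    simp [this]
  · have : (1 : ℝ) ≤ y := by exact_mod_cast hy
    nlinarith

theorem sum_mul_decrement_le {d : ℕ → ℝ} (n : ℕ) :
    ∑ z ∈ Finset.range n, (z : ℝ) * (d z - d (z + 1)) + n * d n =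
      ∑ z ∈ Finset.range n, d (z + 1) := by
  induction n with
  | zero => simp
  | succ n ih =>
    rw [Finset.sum_range_succ, Finset.sum_range_succ, ← ih]
    push_cast
    ring

/-- Rounding to the geometric levels changes a non-increasing function by little. -/
theorem sum_abs_sub_geomRound_le (hδ : 0 < δ) (hδ1 : δ ≤ 1) {d : ℕ → ℝ} {n : ℕ}
    (h0 : ∀ x < n, 0 ≤ d x) (hd : ∀ x y, x ≤ y → y < n → d y ≤ d x) :
    ∑ y ∈ Finset.range n, |d y - d (geomRound δ y)| ≤ 2 * δ * ∑ y ∈ Finset.range n, d y := by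
  rcases n with _ | n
  · simp
  have e1 : ∀ y ∈ Finset.range (n + 1), |d y - d (geomRound δ y)| =
      ∑ z ∈ Finset.range n, if geomRound δ y ≤ z ∧ z < y then d z - d (z + 1) else 0 := by
    intro y hy
    have hy := Finset.mem_range.1 hy
    have hr := geomRound_le δ y
    rw [abs_sub_comm, abs_of_nonneg (sub_nonneg.2 (hd _ _ hr hy)), ← Finset.sum_filter]
    have : (Finset.range n).filter (fun z => geomRound δ y ≤ z ∧ z < y) =
        Finset.Ico (geomRound δ y) y := by
      ext z
      simp only [Finset.mem_filter, Finset.mem_range, Finset.mem_Ico]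
      omega
    rw [this, Finset.sum_Ico_eq_sub _ hr, Finset.sum_range_sub', Finset.sum_range_sub']
    ring
  rw [Finset.sum_congr rfl e1, Finset.sum_comm]
  -- The decrement at `z` is felt only by points `y > z` on the level of `z`, of which there are at
  -- most `2 * δ * z`. Summation by parts then turns the weighted decrements into the sum of `d`.
  have e2 : ∀ z ∈ Finset.range n, (∑ y ∈ Finset.range (n + 1),
      if geomRound δ y ≤ z ∧ z < y then d z - d (z + 1) else 0) ≤
      2 * δ * ((z : ℝ) * (d z - d (z + 1))) := by
    intro z hz
    have hz := Finset.mem_range.1 hz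
    have hdz : 0 ≤ d z - d (z + 1) := sub_nonneg.2 (hd _ _ (by omega) (by omega))
    rw [← Finset.sum_filter, Finset.sum_const, nsmul_eq_mul, ← mul_assoc]
    refine mul_le_mul_of_nonneg_right ?_ hdz
    have hsub : (Finset.range (n + 1)).filter (fun y => geomRound δ y ≤ z ∧ z < y) ⊆
        Finset.Ioc z (z + ⌊2 * δ * z⌋₊) := by
      intro y hy
      simp only [Finset.mem_filter, Finset.mem_range] at hy
      have hlev : geomLevel δ z = geomLevel δ y :=
        le_antisymm (geomLevel_monotone hδ hy.2.2.le)
          (geomLevel_geomRound δ y ▸ geomLevel_monotone hδ hy.2.1)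
      have := sub_le_of_geomLevel_eq hδ hδ1 hy.2.2.le hlev
      rw [← Nat.cast_sub hy.2.2.le] at this
      have := Nat.le_floor this
      rw [Finset.mem_Ioc]
      omega
    have := Finset.card_le_card hsub
    rw [Nat.card_Ioc, Nat.add_sub_cancel_left] at this
    calc _ ≤ ((⌊2 * δ * z⌋₊ : ℕ) : ℝ) := by exact_mod_cast this
      _ ≤ _ := Nat.floor_le (by positivity)
  refine (Finset.sum_le_sum e2).trans ?_
  rw [← Finset.mul_sum]
  have e3 := sum_mul_decrement_le (d := d) n
  have h1 := h0 n (by omega)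
  have h2 := h0 0 (by omega)
  have h3 : (0 : ℝ) ≤ n * d n := by positivity
  have e4 := Finset.sum_range_succ' d n
  have h5 : ∑ z ∈ Finset.range n, (z : ℝ) * (d z - d (z + 1)) ≤
      ∑ y ∈ Finset.range (n + 1), d y := by linarith
  exact mul_le_mul_of_nonneg_left h5 (by positivity)

/-- From `log (1 + δ) ≥ δ / (1 + δ) ≥ δ / 2` and `log 2 ≤ 1`. -/
theorem geomLevel_le (hδ : 0 < δ) (hδ1 : δ ≤ 1) {L y : ℕ} (hy : y < 2 ^ L) :
    (geomLevel δ y : ℝ) ≤ 2 * L / δ := by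
  have h0 : 0 < Real.log (1 + δ) := Real.log_pos (by linarith)
  have h2 : (geomLevel δ y : ℝ) ≤ Real.log (y + 1) / Real.log (1 + δ) :=
    Nat.floor_le (div_nonneg (Real.log_nonneg (by simp)) h0.le)
  refine h2.trans ?_
  have h3 : Real.log (y + 1) ≤ L := by
    have h4 : ((y : ℝ) + 1) ≤ 2 ^ L := by exact_mod_cast hy
    have h5 := Real.log_le_log (by positivity) h4
    rw [Real.log_pow] at h5
    have : Real.log 2 ≤ 1 := by linarith [Real.log_two_lt_d9]
    nlinarith [(Nat.cast_nonneg L : (0 : ℝ) ≤ L)]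
  have h4 : δ / 2 ≤ Real.log (1 + δ) := by
    have := Real.one_sub_inv_le_log_of_pos (show 0 < 1 + δ by linarith)
    have h6 : 1 - (1 + δ)⁻¹ = δ / (1 + δ) := by field_simp; ring
    rw [h6] at this
    refine le_trans ?_ this
    gcongr
    linarith
  calc _ ≤ (L : ℝ) / (δ / 2) := by gcongr
    _ = _ := by field_simp

end Geom

/-! ### Cells of a finite set of cuts, and rounding cell by cell. -/

section Cells

variable {E : Finset ℕ} {N : ℕ}

/-- The last point of `E` up to `x`. -/
def cellStart (E : Finset ℕ) (x : ℕ) : ℕ := Nat.findGreatest (· ∈ E) x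

/-- The first point after `x` that lies in `E` or is at least `N`. -/
noncomputable def cellEnd (E : Finset ℕ) (N x : ℕ) : ℕ := sInf {b | x < b ∧ (b ∈ E ∨ N ≤ b)}

theorem cellStart_le (E : Finset ℕ) (x : ℕ) : cellStart E x ≤ x := Nat.findGreatest_le x

theorem cellStart_mem (h0 : 0 ∈ E) (x : ℕ) : cellStart E x ∈ E :=
  Nat.findGreatest_spec (P := (· ∈ E)) (Nat.zero_le x) h0

theorem le_cellStart {e x : ℕ} (he : e ∈ E) (hx : e ≤ x) : e ≤ cellStart E x :=
  Nat.le_findGreatest hx he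

theorem cellEnd_spec (E : Finset ℕ) (N x : ℕ) :
    x < cellEnd E N x ∧ (cellEnd E N x ∈ E ∨ N ≤ cellEnd E N x) :=
  Nat.sInf_mem (s := {b | x < b ∧ (b ∈ E ∨ N ≤ b)}) ⟨N + x + 1, by omega, Or.inr (by omega)⟩

theorem cellEnd_le {b x : ℕ} (hx : x < b) (hb : b ∈ E ∨ N ≤ b) : cellEnd E N x ≤ b :=
  Nat.sInf_le ⟨hx, hb⟩

theorem cellStart_eq_iff (h0 : 0 ∈ E) {a x : ℕ} (ha : a ∈ E) (hx : x < N) :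
    cellStart E x = a ↔ a ≤ x ∧ x < cellEnd E N a := by
  constructor
  · rintro rfl
    refine ⟨cellStart_le E x, ?_⟩
    by_contra hlt
    rcases cellEnd_spec E N (cellStart E x) with ⟨h1, h2 | h2⟩
    · have := le_cellStart h2 (not_lt.1 hlt); omega
    · omega
  · rintro ⟨h1, h2⟩
    have h3 := le_cellStart ha h1
    by_contra hne
    have h4 : cellEnd E N a ≤ cellStart E x :=
      cellEnd_le (by omega) (Or.inl (cellStart_mem h0 x))
    have := cellStart_le E x
    omega

theorem cellEnd_cellStart (h0 : 0 ∈ E) {x : ℕ} (hx : x < N) :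
    cellEnd E N (cellStart E x) = cellEnd E N x := by
  have h1 := ((cellStart_eq_iff h0 (cellStart_mem h0 x) hx).1 rfl).2
  refine le_antisymm (cellEnd_le ?_ (cellEnd_spec E N x).2)
    (cellEnd_le h1 (cellEnd_spec E N _).2)
  have := (cellEnd_spec E N x).1
  have := cellStart_le E x
  omega

theorem cellStart_pred {n : ℕ} (hn : n ∉ E) : cellStart E n = cellStart E (n - 1) := by
  rcases n with _ | n
  · rfl
  · rw [cellStart, Nat.findGreatest_of_not hn]; rfl

theorem cellEnd_pred {n : ℕ} (hn : n ∉ E) (hN : n < N) : cellEnd E N n = cellEnd E N (n - 1) := by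
  rcases n with _ | n
  · rfl
  · rw [cellEnd, cellEnd]
    congr 1
    ext b
    simp only [Set.mem_ofPred_eq, Nat.add_sub_cancel]
    constructor
    · rintro ⟨h1, h2⟩
      exact ⟨by omega, h2⟩
    · rintro ⟨h1, h2⟩
      refine ⟨?_, h2⟩
      rcases Nat.lt_or_eq_of_le (Nat.succ_le_of_lt h1) with h | rfl
      · exact h
      · rcases h2 with h2 | h2
        · exact absurd h2 hn
        · omega

open Classical in
/-- Rounding of `p` on the cells of `E`: from the left end where `p` is non-increasing on the cell,
otherwise from the right end. -/
noncomputable def cellRound (E : Finset ℕ) (N : ℕ) (δ : ℝ) (p : ℕ → ℝ) (x : ℕ) : ℝ :=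
  if AntitoneOn p (Set.Ico (cellStart E x) (cellEnd E N x)) then
    p (cellStart E x + geomRound δ (x - cellStart E x))
  else p (cellEnd E N x - 1 - geomRound δ (cellEnd E N x - 1 - x))

/-- Requiring both levels to agree covers both directions of rounding, so the condition does not
involve `p` and all components of a mixture can jump only at the same points. -/
theorem cellRound_pred {δ : ℝ} {p : ℕ → ℝ} {n : ℕ} (hn : n ∉ E) (hN : n < N)
    (h1 : geomLevel δ (n - cellStart E n) = geomLevel δ (n - 1 - cellStart E n))
    (h2 : geomLevel δ (cellEnd E N n - 1 - n) = geomLevel δ (cellEnd E N n - 1 - (n - 1))) :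
    cellRound E N δ p n = cellRound E N δ p (n - 1) := by
  rw [cellRound, cellRound, ← cellStart_pred hn, ← cellEnd_pred hn hN, geomRound_congr h1,
    geomRound_congr h2]

theorem sum_cell_abs_sub_cellRound_le {δ : ℝ} (hδ : 0 < δ) (hδ1 : δ ≤ 1) {p : ℕ → ℝ}
    (h0 : ∀ x, 0 ≤ p x) (hE : 0 ∈ E) {a : ℕ} (ha : a ∈ E) (haN : a < N)
    (hmono : AntitoneOn p (Set.Ico a (cellEnd E N a)) ∨
      MonotoneOn p (Set.Ico a (cellEnd E N a))) :
    ∑ x ∈ Finset.Ico a (cellEnd E N a), |p x - cellRound E N δ p x| ≤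
      2 * δ * ∑ x ∈ Finset.Ico a (cellEnd E N a), p x := by
  have hbN : cellEnd E N a ≤ N := cellEnd_le haN (Or.inr le_rfl)
  have hround : ∀ x ∈ Finset.Ico a (cellEnd E N a), cellStart E x = a ∧
      cellEnd E N x = cellEnd E N a := by
    intro x hx
    have hx := Finset.mem_Ico.1 hx
    have hs : cellStart E x = a := (cellStart_eq_iff hE ha (by omega)).2 hx
    exact ⟨hs, by rw [← cellEnd_cellStart hE (by omega : x < N), hs]⟩
  have hab := (cellEnd_spec E N a).1
  set b := cellEnd E N a
  by_cases hanti : AntitoneOn p (Set.Ico a b)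
  · rw [Finset.sum_congr rfl fun x hx => by
      rw [cellRound, (hround x hx).1, (hround x hx).2, if_pos hanti],
      Finset.sum_Ico_eq_sum_range, Finset.sum_Ico_eq_sum_range]
    simp only [Nat.add_sub_cancel_left]
    exact sum_abs_sub_geomRound_le hδ hδ1 (d := fun i => p (a + i)) (fun _ _ => h0 _)
      fun x y hxy hy => hanti ⟨by omega, by omega⟩ ⟨by omega, by omega⟩ (by omega)
  · have hm := hmono.resolve_left hanti
    rw [Finset.sum_congr rfl fun x hx => by
      rw [cellRound, (hround x hx).1, (hround x hx).2, if_neg hanti],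
      Finset.sum_Ico_eq_sum_range, Finset.sum_Ico_eq_sum_range,
      ← Finset.sum_range_reflect, ← Finset.sum_range_reflect (fun i => p (a + i))]
    have := sum_abs_sub_geomRound_le hδ hδ1 (d := fun i => p (b - 1 - i)) (n := b - a)
      (fun _ _ => h0 _)
      fun x y hxy hy => hm ⟨by omega, by omega⟩ ⟨by omega, by omega⟩ (by omega)
    refine le_trans (le_of_eq ?_) (this.trans (le_of_eq ?_))
    · refine Finset.sum_congr rfl fun i hi => ?_
      have hi := Finset.mem_range.1 hi
      rw [show a + (b - a - 1 - i) = b - 1 - i by omega,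
        show b - 1 - (b - 1 - i) = i by omega]
    · congr 1
      refine Finset.sum_congr rfl fun i hi => ?_
      have hi := Finset.mem_range.1 hi
      rw [show a + (b - a - 1 - i) = b - 1 - i by omega]

theorem sum_abs_sub_cellRound_le {δ : ℝ} (hδ : 0 < δ) (hδ1 : δ ≤ 1) {p : ℕ → ℝ}
    (h0 : ∀ x, 0 ≤ p x) (hE : 0 ∈ E) (hEN : ∀ e ∈ E, e < N)
    (hmono : ∀ a ∈ E, AntitoneOn p (Set.Ico a (cellEnd E N a)) ∨
      MonotoneOn p (Set.Ico a (cellEnd E N a))) :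
    ∑ x ∈ Finset.range N, |p x - cellRound E N δ p x| ≤ 2 * δ * ∑ x ∈ Finset.range N, p x := by
  have hfib : ∀ F : ℕ → ℝ, ∑ x ∈ Finset.range N, F x =
      ∑ a ∈ E, ∑ x ∈ Finset.Ico a (cellEnd E N a), F x := by
    intro F
    rw [← Finset.sum_fiberwise_of_maps_to (s := Finset.range N) (t := E) (g := cellStart E)
      fun x _ => cellStart_mem hE x]
    refine Finset.sum_congr rfl fun a ha => ?_
    have hbN : cellEnd E N a ≤ N := cellEnd_le (hEN a ha) (Or.inr le_rfl)
    congr 1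
    ext x
    simp only [Finset.mem_filter, Finset.mem_range, Finset.mem_Ico]
    constructor
    · rintro ⟨h1, h2⟩
      exact (cellStart_eq_iff hE ha h1).1 h2
    · intro h
      exact ⟨by omega, (cellStart_eq_iff hE ha (by omega)).2 h⟩
  rw [hfib, hfib, Finset.mul_sum]
  exact Finset.sum_le_sum fun a ha =>
    sum_cell_abs_sub_cellRound_le hδ hδ1 h0 hE ha (hEN a ha) (hmono a ha)

/-- A function that jumps only at points of `E` and at changes of the geometric level, seen from
the ends of the cells, has few jumps. -/
theorem jumpCount_le_of_cells {δ : ℝ} (hδ : 0 < δ) (hδ1 : δ ≤ 1) {L : ℕ} (hL : 1 ≤ L)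
    (hE : 0 ∈ E) (hgrid : ∀ n < N, 2 ^ L * (n / 2 ^ L) ∈ E) {g : ℕ → ℝ}
    (hg : ∀ n < N, n ∉ E →
      geomLevel δ (n - cellStart E n) = geomLevel δ (n - 1 - cellStart E n) →
      geomLevel δ (cellEnd E N n - 1 - n) = geomLevel δ (cellEnd E N n - 1 - (n - 1)) →
      g n = g (n - 1)) :
    (jumpCount g N : ℝ) ≤ E.card * (7 * L / δ) := by
  classical
  set K := ⌊2 * (L : ℝ) / δ⌋₊
  have hlev : ∀ y < 2 ^ L, geomLevel δ y ∈ Finset.range (K + 1) := fun y hy =>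
    Finset.mem_range.2 (Nat.lt_succ_of_le (Nat.le_floor (geomLevel_le hδ hδ1 hy)))
  have hlen : ∀ n < N, n - cellStart E n < 2 ^ L ∧ cellEnd E N n - 1 - n < 2 ^ L := by
    intro n hn
    have h2 : 0 < 2 ^ L := by positivity
    have hdm := Nat.div_add_mod n (2 ^ L)
    have hlt := Nat.mod_lt n h2
    have h1 := le_cellStart (x := n) (hgrid n hn) (by omega)
    refine ⟨by omega, ?_⟩
    have h3 : cellEnd E N n ≤ 2 ^ L * (n / 2 ^ L) + 2 ^ L := by
      refine cellEnd_le (by omega) ?_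
      by_cases hc : 2 ^ L * (n / 2 ^ L) + 2 ^ L < N
      · left
        have := hgrid _ hc
        rwa [Nat.mul_add_div h2, Nat.div_self h2, mul_add, mul_one] at this
      · exact Or.inr (not_lt.1 hc)
    have := cellEnd_spec E N n
    omega
  set J1 := (Finset.range N).filter fun n => n ∉ E ∧
    geomLevel δ (n - cellStart E n) ≠ geomLevel δ (n - 1 - cellStart E n)
  set J2 := (Finset.range N).filter fun n => n ∉ E ∧
    geomLevel δ (cellEnd E N n - 1 - n) ≠ geomLevel δ (cellEnd E N n - 1 - (n - 1))
  have hsub : (Finset.range N).filter (fun x => g x ≠ g (x - 1)) ⊆ E ∪ (J1 ∪ J2) := by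
    intro n hn
    simp only [Finset.mem_filter, Finset.mem_union, J1, J2] at hn ⊢
    by_contra hcon
    push Not at hcon
    obtain ⟨hnE, h1, h2⟩ := hcon
    exact hn.2 (hg n (Finset.mem_range.1 hn.1) hnE (h1 hn.1 hnE) (h2 hn.1 hnE))
  -- Such a point is the first one in its cell with its level, so cell and level determine it.
  have hJ1 : J1.card ≤ (E ×ˢ Finset.range (K + 1)).card := by
    refine Finset.card_le_card_of_injOn
      (fun n => (cellStart E n, geomLevel δ (n - cellStart E n))) ?_ ?_
    · intro n hn
      have hn := (Finset.mem_filter.1 hn).1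
      simp only [Finset.coe_product, Set.mem_prod, Finset.mem_coe]
      exact ⟨cellStart_mem hE n, hlev _ (hlen n (Finset.mem_range.1 hn)).1⟩
    · have key : ∀ n ∈ J1, ∀ n' ∈ J1, cellStart E n = cellStart E n' →
          geomLevel δ (n - cellStart E n) = geomLevel δ (n' - cellStart E n') → ¬ n < n' := by
        intro n hn n' hn' h1 h2 hlt
        have hn' := (Finset.mem_filter.1 hn').2.2
        apply hn'
        refine le_antisymm ?_ (geomLevel_monotone hδ (by omega))
        rw [← h2, h1]
        exact geomLevel_monotone hδ (by omega)
      intro n hn n' hn' h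
      simp only [Prod.mk.injEq] at h
      have k1 := key n hn n' hn' h.1 h.2
      have k2 := key n' hn' n hn h.1.symm h.2.symm
      omega
  have hJ2 : J2.card ≤ (E ×ˢ Finset.range (K + 1)).card := by
    refine Finset.card_le_card_of_injOn
      (fun n => (cellStart E n, geomLevel δ (cellEnd E N n - 1 - n))) ?_ ?_
    · intro n hn
      have hn := (Finset.mem_filter.1 hn).1
      simp only [Finset.coe_product, Set.mem_prod, Finset.mem_coe]
      exact ⟨cellStart_mem hE n, hlev _ (hlen n (Finset.mem_range.1 hn)).2⟩
    · have key : ∀ n ∈ J2, ∀ n' ∈ J2, cellStart E n = cellStart E n' →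
          geomLevel δ (cellEnd E N n - 1 - n) = geomLevel δ (cellEnd E N n' - 1 - n') →
          ¬ n < n' := by
        intro n hn n' hn' h1 h2 hlt
        have hnN := Finset.mem_range.1 (Finset.mem_filter.1 hn).1
        have hnN' := Finset.mem_range.1 (Finset.mem_filter.1 hn').1
        have hn' := (Finset.mem_filter.1 hn').2.2
        have he : cellEnd E N n = cellEnd E N n' := by
          rw [← cellEnd_cellStart hE hnN, h1, cellEnd_cellStart hE hnN']
        apply hn'
        refine le_antisymm (geomLevel_monotone hδ (by omega)) ?_
        rw [← h2, he]
        exact geomLevel_monotone hδ (by omega)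
      intro n hn n' hn' h
      simp only [Prod.mk.injEq] at h
      have k1 := key n hn n' hn' h.1 h.2
      have k2 := key n' hn' n hn h.1.symm h.2.symm
      omega
  have hcard : jumpCount g N ≤ E.card * (2 * K + 3) := by
    have h1 := (Finset.card_le_card hsub).trans
      ((Finset.card_union_le _ _).trans
        (Nat.add_le_add_left (Finset.card_union_le _ _) _))
    rw [Finset.card_product, Finset.card_range] at hJ1 hJ2
    have h2 : jumpCount g N ≤ E.card + (J1.card + J2.card) := by
      rw [jumpCount]
      convert h1
    nlinarith
  have hK : (K : ℝ) ≤ 2 * L / δ := Nat.floor_le (by positivity)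
  have hL1 : 1 ≤ (L : ℝ) / δ := by
    rw [le_div_iff₀ hδ]
    have : (1 : ℝ) ≤ L := by exact_mod_cast hL
    linarith
  calc (jumpCount g N : ℝ) ≤ E.card * (2 * K + 3) := by exact_mod_cast hcard
    _ ≤ E.card * (7 * L / δ) := by
      gcongr
      rw [mul_div_assoc] at hK ⊢
      linarith

end Cells

/-! ### Cuts of modal distributions and histograms near mixtures. -/

/-- Extension by zero of a function on `Fin N` to the natural numbers. -/
noncomputable def extendZero {N : ℕ} (f : Fin N → ℝ) (x : ℕ) : ℝ :=
  if h : x < N then f ⟨x, h⟩ else 0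

theorem extendZero_val {N : ℕ} (f : Fin N → ℝ) (x : Fin N) : extendZero f x = f x := by
  simp [extendZero]

theorem prefixSum_extendZero {N : ℕ} (f : Fin N → ℝ) : prefixSum (extendZero f) N = ∑ x, f x := by
  rw [prefixSum, ← Fin.sum_univ_eq_sum_range]
  simp [extendZero]

theorem extendZero_nonneg {N : ℕ} {f : Fin N → ℝ} (h : ∀ x, 0 ≤ f x) (x : ℕ) :
    0 ≤ extendZero f x := by
  rw [extendZero]
  split_ifs
  · exact h _
  · exact le_rfl

/-- Finitely many points cut the domain of a modal distribution so that it is monotone on every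
cell, and on the cells of every finer subdivision. -/
theorem IsModal.exists_cuts {N t : ℕ} {p : Fin N → ℝ} (hp : IsModal t p) :
    ∃ E₀ : Finset ℕ, E₀.card ≤ 2 * t ∧ (∀ e ∈ E₀, e < N) ∧ ∀ E : Finset ℕ, E₀ ⊆ E →
      ∀ a < N, AntitoneOn (extendZero p) (Set.Ico a (cellEnd E N a)) ∨
        MonotoneOn (extendZero p) (Set.Ico a (cellEnd E N a)) := by
  classical
  obtain ⟨-, P, hPt, hP⟩ := hp
  rcases N.eq_zero_or_pos with rfl | hN
  · exact ⟨∅, by simp, by simp, fun _ _ a ha => absurd ha (Nat.not_lt_zero a)⟩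
  have : Nonempty (Fin N) := ⟨⟨0, hN⟩⟩
  choose! hconn j hj hmono hanti using hP
  have hne : ∀ J ∈ P.parts, ∃ u ∈ J, ∀ x ∈ J, u ≤ x := fun J hJ => by
    obtain ⟨u, hu, hmin⟩ := J.exists_min_image id (P.nonempty_of_mem_parts hJ)
    exact ⟨u, hu, hmin⟩
  choose! u hu hmin using hne
  -- The cuts are the least element and the mode of each part.
  refine ⟨P.parts.image (fun J => (u J : ℕ)) ∪ P.parts.image (fun J => (j J : ℕ)), ?_, ?_, ?_⟩
  · have h1 := Finset.card_union_le (P.parts.image fun J => (u J : ℕ))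
      (P.parts.image fun J => (j J : ℕ))
    have h2 := Finset.card_image_le (s := P.parts) (f := fun J => (u J : ℕ))
    have h3 := Finset.card_image_le (s := P.parts) (f := fun J => (j J : ℕ))
    omega
  · intro e he
    simp only [Finset.mem_union, Finset.mem_image] at he
    rcases he with ⟨J, -, rfl⟩ | ⟨J, -, rfl⟩
    · exact (u J).2
    · exact (j J).2
  · intro E hE a ha
    have hcut : ∀ e : Fin N, (∃ J ∈ P.parts, e = u J ∨ e = j J) → (e : ℕ) ∈ E := by
      rintro e ⟨J, hJ, rfl | rfl⟩
      · exact hE (Finset.mem_union_left _ (Finset.mem_image_of_mem _ hJ))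
      · exact hE (Finset.mem_union_right _ (Finset.mem_image_of_mem _ hJ))
    have hout : ∀ e : Fin N, (∃ J ∈ P.parts, e = u J ∨ e = j J) → ∀ x : ℕ,
        x < cellEnd E N a → (e : ℕ) ≤ x → (e : ℕ) ≤ a := by
      intro e he x hx hex
      by_contra hlt
      have := cellEnd_le (N := N) (not_le.1 hlt) (Or.inl (hcut e he))
      omega
    have hend : cellEnd E N a ≤ N := cellEnd_le ha (Or.inr le_rfl)
    obtain ⟨J, hJ, haJ⟩ := P.exists_mem (Finset.mem_univ (⟨a, ha⟩ : Fin N))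
    -- The part containing `x` starts at a cut, which cannot lie in `(a, x]`; being an interval,
    -- that part contains `a` too, so it is `J`.
    have hcell : ∀ x (hx : x < N), a ≤ x → x < cellEnd E N a → (⟨x, hx⟩ : Fin N) ∈ J := by
      intro x hx hax hxe
      obtain ⟨J', hJ', hxJ'⟩ := P.exists_mem (Finset.mem_univ (⟨x, hx⟩ : Fin N))
      have h1 : (u J' : ℕ) ≤ x := Fin.le_def.1 (hmin J' hJ' _ hxJ')
      have h2 := hout (u J') ⟨J', hJ', Or.inl rfl⟩ x hxe h1
      have h3 : (⟨a, ha⟩ : Fin N) ∈ J' := by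
        have := (hconn J' hJ').out (Finset.mem_coe.2 (hu J' hJ')) (Finset.mem_coe.2 hxJ')
        exact this ⟨Fin.le_def.2 h2, Fin.le_def.2 hax⟩
      rwa [P.eq_of_mem_parts hJ hJ' haJ h3]
    by_cases hja : (j J : ℕ) ≤ a
    · left
      intro x hx y hy hxy
      have hxN : x < N := lt_of_lt_of_le hx.2 hend
      have hyN : y < N := lt_of_lt_of_le hy.2 hend
      have := hanti J hJ ⟨Finset.mem_coe.2 (hcell x hxN hx.1 hx.2),
        Fin.le_def.2 (hja.trans hx.1)⟩ ⟨Finset.mem_coe.2 (hcell y hyN hy.1 hy.2),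
        Fin.le_def.2 (hja.trans hy.1)⟩ (Fin.le_def.2 hxy)
      simpa [extendZero, hxN, hyN] using this
    · right
      have hlt : ∀ x < cellEnd E N a, x ≤ (j J : ℕ) := by
        intro x hx
        by_contra hcon
        exact hja (hout (j J) ⟨J, hJ, Or.inr rfl⟩ x hx (not_le.1 hcon).le)
      intro x hx y hy hxy
      have hxN : x < N := lt_of_lt_of_le hx.2 hend
      have hyN : y < N := lt_of_lt_of_le hy.2 hend
      have := hmono J hJ ⟨Finset.mem_coe.2 (hcell x hxN hx.1 hx.2),
        Fin.le_def.2 (hlt x hx.2)⟩ ⟨Finset.mem_coe.2 (hcell y hyN hy.1 hy.2),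
        Fin.le_def.2 (hlt y hy.2)⟩ (Fin.le_def.2 hxy)
      simpa [extendZero, hxN, hyN] using this

/-- All components are rounded on one common subdivision. The number of jumps is thus governed by
the total number of cuts, of order `k * t`, without a further factor `k` for the components. -/
theorem exists_histogram_near {N k t L : ℕ} (hL : 1 ≤ L) (hN0 : 0 < N)
    (hN : N ≤ k * t * 2 ^ L) {δ : ℝ} (hδ : 0 < δ) (hδ1 : δ ≤ 1) {q : Fin N → ℝ}
    (hq : q ∈ modalMixtures N k t) :
    ∃ g : ℕ → ℝ, (∀ x, 0 ≤ g x ∧ g x ≤ 1) ∧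
      (jumpCount g N : ℝ) ≤ 21 * (k * t * L) / δ ∧
      ∑ x ∈ Finset.range N, |extendZero q x - g x| ≤ 2 * δ := by
  classical
  obtain ⟨w, ⟨hw0, hw1⟩, p, hp, rfl⟩ := hq
  choose E₀ hcard hlt hcuts using fun i => (hp i).exists_cuts
  -- By `hN` these `k * t` multiples already include every multiple of `2 ^ L` below `N`.
  set G := ((Finset.range (k * t)).image fun c => 2 ^ L * c).filter (· < N)
  set E := G ∪ Finset.univ.biUnion E₀
  have h2 : 0 < 2 ^ L := by positivity
  have hgrid : ∀ n < N, 2 ^ L * (n / 2 ^ L) ∈ E := by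
    intro n hn
    refine Finset.mem_union_left _ (Finset.mem_filter.2 ⟨Finset.mem_image_of_mem _
      (Finset.mem_range.2 ?_), (Nat.mul_div_le _ _).trans_lt hn⟩)
    rw [Nat.div_lt_iff_lt_mul h2]
    omega
  have hE0 : 0 ∈ E := by simpa using hgrid 0 hN0
  have hEN : ∀ e ∈ E, e < N := by
    intro e he
    rcases Finset.mem_union.1 he with he | he
    · exact (Finset.mem_filter.1 he).2
    · obtain ⟨i, -, hi⟩ := Finset.mem_biUnion.1 he
      exact hlt i e hi
  have hEcard : E.card ≤ 3 * (k * t) := by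
    have h1 : G.card ≤ k * t :=
      (Finset.card_filter_le _ _).trans (Finset.card_image_le.trans (by simp))
    have h3 : (Finset.univ.biUnion E₀).card ≤ k * (2 * t) := by
      refine Finset.card_biUnion_le.trans ((Finset.sum_le_sum fun i _ => hcard i).trans ?_)
      simp
    have := Finset.card_union_le G (Finset.univ.biUnion E₀)
    nlinarith
  have hpx0 : ∀ i x, 0 ≤ extendZero (p i) x := fun i => extendZero_nonneg (hp i).1.1
  have hpx1 : ∀ i x, extendZero (p i) x ≤ 1 := by
    intro i x
    rw [extendZero]
    split_ifs with h
    · rw [← (hp i).1.2]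
      exact Finset.single_le_sum (fun y _ => (hp i).1.1 y) (Finset.mem_univ _)
    · exact zero_le_one
  have hr : ∀ i x, 0 ≤ cellRound E N δ (extendZero (p i)) x ∧
      cellRound E N δ (extendZero (p i)) x ≤ 1 := by
    intro i x
    rw [cellRound]
    split_ifs
    · exact ⟨hpx0 _ _, hpx1 _ _⟩
    · exact ⟨hpx0 _ _, hpx1 _ _⟩
  refine ⟨fun x => ∑ i, w i * cellRound E N δ (extendZero (p i)) x, fun x => ⟨?_, ?_⟩, ?_, ?_⟩
  · exact Finset.sum_nonneg fun i _ => mul_nonneg (hw0 i) (hr i x).1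
  · rw [← hw1]
    exact Finset.sum_le_sum fun i _ => mul_le_of_le_one_right (hw0 i) (hr i x).2
  · have h := jumpCount_le_of_cells (N := N) hδ hδ1 hL hE0 hgrid
      (g := fun x => ∑ i, w i * cellRound E N δ (extendZero (p i)) x)
      fun n hn hnE h1 h2 => Finset.sum_congr rfl fun i _ => by
        rw [cellRound_pred hnE hn h1 h2]
    refine h.trans ?_
    have : (E.card : ℝ) ≤ 3 * (k * t) := by exact_mod_cast hEcard
    calc (E.card : ℝ) * (7 * L / δ) ≤ 3 * (k * t) * (7 * L / δ) := by gcongr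
      _ = _ := by ring
  · have hi : ∀ i, ∑ x ∈ Finset.range N,
        |extendZero (p i) x - cellRound E N δ (extendZero (p i)) x| ≤ 2 * δ := by
      intro i
      have := sum_abs_sub_cellRound_le hδ hδ1 (hpx0 i) hE0 hEN fun a ha =>
        hcuts i E (fun e he => Finset.mem_union_right _
          (Finset.mem_biUnion.2 ⟨i, Finset.mem_univ _, he⟩)) a (hEN a ha)
      have h1 := prefixSum_extendZero (p i)
      rw [(hp i).1.2, prefixSum] at h1
      rwa [h1, mul_one] at this
    have hx : ∀ x ∈ Finset.range N, |extendZero (fun x => ∑ i, w i * p i x) x -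
        ∑ i, w i * cellRound E N δ (extendZero (p i)) x| ≤
        ∑ i, w i * |extendZero (p i) x - cellRound E N δ (extendZero (p i)) x| := by
      intro x hx
      have hx := Finset.mem_range.1 hx
      have e : extendZero (fun x => ∑ i, w i * p i x) x = ∑ i, w i * extendZero (p i) x := by
        simp [extendZero, hx]
      rw [e, ← Finset.sum_sub_distrib]
      refine (Finset.abs_sum_le_sum_abs _ _).trans (Finset.sum_le_sum fun i _ => ?_)
      rw [← mul_sub, abs_mul, abs_of_nonneg (hw0 i)]
    refine (Finset.sum_le_sum hx).trans ?_
    rw [Finset.sum_comm]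
    simp only [← Finset.mul_sum]
    calc _ ≤ ∑ i, w i * (2 * δ) :=
          Finset.sum_le_sum fun i _ => mul_le_mul_of_nonneg_left (hi i) (hw0 i)
      _ = 2 * δ := by rw [← Finset.sum_mul, hw1, one_mul]

namespace RealRAM

/-! ### Running programs -/

/-- The empty program. -/
def skip : Prog := .loop (.nlt 0 0) (.atom (.nconst 0 0))

/-- Straight-line code. -/
def code : List Instr → Prog
  | [] => skip
  | c :: cs => .seq (.atom c) (code cs)

theorem exec_skip (ω : ℕ → ℕ) (s : State) : Exec ω skip s 1 s :=
  .loop_false (by simp [Test.Holds])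

theorem exec_code (ω : ℕ → ℕ) (cs : List Instr) (h : ∀ c ∈ cs, ∀ s, c.cost s = 1) (s : State) :
    Exec ω (code cs) s (cs.length + 1) (cs.foldl (fun s c => c.apply ω s) s) := by
  induction cs generalizing s with
  | nil => exact exec_skip ω s
  | cons c cs ih =>
    have h1 := Exec.atom (ω := ω) c s
    rw [h c (by simp)] at h1
    have := h1.seq (ih (fun c hc => h c (by simp [hc])) (c.apply ω s))
    rwa [List.length_cons, show cs.length + 1 + 1 = 1 + (cs.length + 1) by omega]

/-- Loop rule with the iteration number in the invariant: `n` bodies of at most `c` steps and `n +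
1` tests. -/
theorem exec_loop_count {ω : ℕ → ℕ} {b : Test} {p : Prog} (I : ℕ → State → Prop) {n c : ℕ}
    (hstep : ∀ j < n, ∀ s, I j s → b.Holds s ∧ ∃ T s', Exec ω p s T s' ∧ T ≤ c ∧ I (j + 1) s')
    (hend : ∀ s, I n s → ¬ b.Holds s) {s : State} (h0 : I 0 s) :
    ∃ T s', Exec ω (.loop b p) s T s' ∧ T ≤ (c + 1) * n + 1 ∧ I n s' := by
  have key : ∀ d j, j + d = n → ∀ s, I j s →
      ∃ T s', Exec ω (.loop b p) s T s' ∧ T ≤ (c + 1) * d + 1 ∧ I n s' := by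
    intro d
    induction d with
    | zero =>
      intro j hj s hs
      obtain rfl : j = n := by omega
      exact ⟨1, s, .loop_false (hend s hs), by omega, hs⟩
    | succ d ih =>
      intro j hj s hs
      obtain ⟨hb, T, s', he, hT, hs'⟩ := hstep j (by omega) s hs
      obtain ⟨T', s'', he', hT', hs''⟩ := ih (j + 1) (by omega) s' hs'
      exact ⟨_, s'', .loop_true hb he he', by rw [mul_add]; omega, hs''⟩
  exact key n 0 (by omega) s h0

/-! ### Updating the cone of slopes -/

/-- Intersect the cone of slopes `[r₁₁, r₁₂]` with the constraint at the point `(n₁₀, r₁₄)`;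
the result goes to `r₁₈` and `r₁₉`. -/
def coneCode : Prog :=
  .seq (code [.rcast 16 10, .rcast 17 8, .rsub 16 16 17, .rsub 17 14 13, .rsub 18 17 9,
      .rdiv 18 18 16, .radd 19 17 9, .rdiv 19 19 16])
    -- Throughout the scan `r₂₀ = 0` and `n₁₃ = 0`, so adding them copies a register.
    (.seq (.cond (.rlt 18 11) (code [.radd 18 11 20]) skip)
      (.cond (.rlt 12 19) (code [.radd 19 12 20]) skip))

/-- Accept the point `(n₁₀, r₁₄)` as the new right end of the current interval. -/
def acceptCode : Prog :=
  code [.radd 11 18 20, .radd 12 19 20, .nadd 9 10 13, .radd 15 14 20]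

/-- Output the current interval and the one from its right end to `(n₁₀, r₁₄)`, where the next
interval starts. -/
def closeCode : Prog :=
  -- `r₁₁` is still the lower end of the cone before the rejected point. As `n₅ = 1`, the emitted
  -- ends are the last points of the intervals.
  code [.nsub 11 9 5, .emit 11 11, .rcast 16 10, .rcast 17 9, .rsub 16 16 17, .rsub 17 14 15,
    .rdiv 17 17 16, .nsub 11 10 5, .emit 11 17, .nadd 8 10 13, .nadd 9 10 13, .radd 13 14 20,
    .radd 15 14 20, .radd 11 20 20, .radd 12 4 20]

/-- Process the point `(n₁₀, r₁₄)`. -/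
def pointCode : Prog :=
  .cond (.nlt 9 10) (.seq coneCode (.cond (.rle 18 19) acceptCode closeCode)) skip

/-- Meaning of the registers during the scan of the distribution function `Z`. -/
structure ScanInv (Z : ℕ → ℝ) (τ : ℝ) (s : State) : Prop where
  n5 : s.nreg 5 = 1
  n13 : s.nreg 13 = 0
  r4 : s.rreg 4 = 1
  r20 : s.rreg 20 = 0
  r9 : s.rreg 9 = τ
  greedy : GreedyFit Z τ s.out (s.nreg 8)
  le : s.nreg 8 ≤ s.nreg 9
  r13 : s.rreg 13 = Z (s.nreg 8)
  r15 : s.rreg 15 = Z (s.nreg 9)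
  cone : ∀ σ, (s.rreg 11 ≤ σ ∧ σ ≤ s.rreg 12) ↔ Fits Z τ (s.nreg 8) (s.nreg 9) σ
  cone_nonempty : s.rreg 11 ≤ s.rreg 12

theorem fits_refl_iff {Z : ℕ → ℝ} {τ : ℝ} (hτ : 0 ≤ τ) (a : ℕ) (σ : ℝ) :
    Fits Z τ a a σ ↔ 0 ≤ σ ∧ σ ≤ 1 := by
  refine ⟨fun h => ⟨h.1, h.2.1⟩, fun h => ⟨h.1, h.2, fun n h1 h2 => ?_⟩⟩
  obtain rfl : n = a := by omega
  simpa using hτ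

/-- Between `b` and `y` either there is no point or `Z` is flat; on a flat stretch a line of slope
`σ ≥ 0` is monotone, so its deviation lies between those at the two ends. One test at `y` suffices.
-/
theorem fits_extend_iff {Z : ℕ → ℝ} {τ : ℝ} {a b y : ℕ} (hab : a ≤ b) (hby : b < y)
    (hgap : y = b + 1 ∨ ∀ n, b ≤ n → n ≤ y → Z n = Z b) (σ : ℝ) :
    Fits Z τ a y σ ↔ Fits Z τ a b σ ∧ |Z y - Z a - σ * ((y : ℝ) - a)| ≤ τ := by
  constructor
  · exact fun h => ⟨⟨h.1, h.2.1, fun n h1 h2 => h.2.2 n h1 (by omega)⟩,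
      h.2.2 y (by omega) le_rfl⟩
  · rintro ⟨h, hy⟩
    refine ⟨h.1, h.2.1, fun n h1 h2 => ?_⟩
    rcases Nat.lt_or_ge b n with hbn | hbn
    · rcases h2.eq_or_lt with rfl | hny
      · exact hy
      · have hc := hgap.resolve_left (by omega)
        have hb := h.2.2 b hab le_rfl
        rw [hc y (by omega) le_rfl] at hy
        rw [hc n hbn.le h2]
        have c1 : (b : ℝ) ≤ n := by exact_mod_cast hbn.le
        have c2 : (n : ℝ) ≤ y := by exact_mod_cast h2
        have k1 := mul_le_mul_of_nonneg_left c1 h.1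
        have k2 := mul_le_mul_of_nonneg_left c2 h.1
        rw [abs_le] at hb hy ⊢
        constructor <;> linarith
    · exact h.2.2 n h1 hbn

/-- Crossing a single gap is always possible exactly at both ends, so the second piece of a closed
block needs no search. -/
theorem fits_chord {Z : ℕ → ℝ} {τ : ℝ} (hτ : 0 ≤ τ) (hZ : Monotone Z)
    (hZ1 : ∀ n, 0 ≤ Z n ∧ Z n ≤ 1) {b y : ℕ} (hby : b < y)
    (hgap : y = b + 1 ∨ ∀ n, b ≤ n → n ≤ y → Z n = Z b) :
    Fits Z τ b y ((Z y - Z b) / ((y : ℝ) - b)) := by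
  have hd : (1 : ℝ) ≤ (y : ℝ) - b := by
    have : (b : ℝ) + 1 ≤ y := by exact_mod_cast hby
    linarith
  have h0 : 0 ≤ Z y - Z b := sub_nonneg.2 (hZ hby.le)
  have h1 : (Z y - Z b) / ((y : ℝ) - b) ≤ 1 := by
    rw [div_le_one (by linarith)]
    linarith [(hZ1 y).2, (hZ1 b).1]
  rw [fits_extend_iff le_rfl hby hgap, fits_refl_iff hτ]
  refine ⟨⟨div_nonneg h0 (by linarith), h1⟩, ?_⟩
  rw [div_mul_cancel₀ _ (by linarith), sub_self, abs_zero]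
  exact hτ

theorem abs_sub_mul_le_iff {e τ σ d : ℝ} (hd : 0 < d) :
    |e - σ * d| ≤ τ ↔ (e - τ) / d ≤ σ ∧ σ ≤ (e + τ) / d := by
  rw [div_le_iff₀ hd, le_div_iff₀ hd, abs_le]
  constructor <;> rintro ⟨h1, h2⟩ <;> constructor <;> linarith

theorem exec_coneCode (ω : ℕ → ℕ) (s : State) (h20 : s.rreg 20 = 0) :
    ∃ T r, Exec ω coneCode s T { s with rreg := r } ∧ T ≤ 15 ∧
      (∀ i, i < 16 ∨ 20 ≤ i → r i = s.rreg i) ∧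
      r 18 = max (s.rreg 11) ((s.rreg 14 - s.rreg 13 - s.rreg 9) /
        ((s.nreg 10 : ℝ) - s.nreg 8)) ∧
      r 19 = min (s.rreg 12) ((s.rreg 14 - s.rreg 13 + s.rreg 9) /
        ((s.nreg 10 : ℝ) - s.nreg 8)) := by
  have e1 := exec_code ω [.rcast 16 10, .rcast 17 8, .rsub 16 16 17, .rsub 17 14 13,
    .rsub 18 17 9, .rdiv 18 18 16, .radd 19 17 9, .rdiv 19 19 16]
    (by simp [Instr.cost]) s
  obtain ⟨r1, hs1, hr1, h18, h19⟩ : ∃ r1, [Instr.rcast 16 10, .rcast 17 8, .rsub 16 16 17,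
      .rsub 17 14 13, .rsub 18 17 9, .rdiv 18 18 16, .radd 19 17 9, .rdiv 19 19 16].foldl
        (fun s c => c.apply ω s) s = { s with rreg := r1 } ∧
      (∀ i, i < 16 ∨ 20 ≤ i → r1 i = s.rreg i) ∧
      r1 18 = (s.rreg 14 - s.rreg 13 - s.rreg 9) / ((s.nreg 10 : ℝ) - s.nreg 8) ∧
      r1 19 = (s.rreg 14 - s.rreg 13 + s.rreg 9) / ((s.nreg 10 : ℝ) - s.nreg 8) := by
    refine ⟨_, rfl, ?_, ?_, ?_⟩
    · intro i hi
      simp only [Instr.apply]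
      rw [Function.update_of_ne (by omega), Function.update_of_ne (by omega),
        Function.update_of_ne (by omega), Function.update_of_ne (by omega),
        Function.update_of_ne (by omega), Function.update_of_ne (by omega),
        Function.update_of_ne (by omega), Function.update_of_ne (by omega)]
    · simp [Instr.apply, Function.update]
    · simp [Instr.apply, Function.update]
  rw [hs1] at e1
  obtain ⟨T2, r2, e2, hT2, hr2, h18', h19'⟩ : ∃ T r2,
      Exec ω (.cond (.rlt 18 11) (code [.radd 18 11 20]) skip) { s with rreg := r1 } T
        { s with rreg := r2 } ∧ T ≤ 3 ∧ (∀ i, i < 16 ∨ 20 ≤ i → r2 i = s.rreg i) ∧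
      r2 18 = max (s.rreg 11) (r1 18) ∧ r2 19 = r1 19 := by
    by_cases hlt : r1 18 < r1 11
    · refine ⟨_, _, .cond_true hlt (exec_code ω _ (by simp [Instr.cost]) _), by simp, ?_, ?_, ?_⟩
      · intro i hi
        simp only
        rw [Function.update_of_ne (by omega), hr1 i hi]
      · rw [hr1 11 (by omega)] at hlt
        simp [hr1, h20, max_eq_left hlt.le]
      · simp
    · refine ⟨_, r1, .cond_false hlt (exec_skip ω _), by simp, hr1, ?_, rfl⟩
      rw [hr1 11 (by omega)] at hlt
      rw [max_eq_right (not_lt.1 hlt)]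
  obtain ⟨T3, r3, e3, hT3, hr3, h18'', h19''⟩ : ∃ T r3,
      Exec ω (.cond (.rlt 12 19) (code [.radd 19 12 20]) skip) { s with rreg := r2 } T
        { s with rreg := r3 } ∧ T ≤ 3 ∧ (∀ i, i < 16 ∨ 20 ≤ i → r3 i = s.rreg i) ∧
      r3 18 = r2 18 ∧ r3 19 = min (s.rreg 12) (r2 19) := by
    by_cases hlt : r2 12 < r2 19
    · refine ⟨_, _, .cond_true hlt (exec_code ω _ (by simp [Instr.cost]) _), by simp, ?_, ?_, ?_⟩
      · intro i hi
        simp only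
        rw [Function.update_of_ne (by omega), hr2 i hi]
      · simp
      · rw [hr2 12 (by omega)] at hlt
        simp [hr2, h20, min_eq_left hlt.le]
    · refine ⟨_, r2, .cond_false hlt (exec_skip ω _), by simp, hr2, rfl, ?_⟩
      rw [hr2 12 (by omega)] at hlt
      rw [min_eq_right (not_lt.1 hlt)]
  refine ⟨_, r3, e1.seq (e2.seq e3), ?_, hr3, ?_, ?_⟩
  · simp only [List.length_cons, List.length_nil]; omega
  · rw [h18'', h18', h18]
  · rw [h19'', h19', h19]

/-- The fitting slopes form an interval and the new point adds two linear constraints, so a constant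
number of operations decides whether the block can be extended. -/
theorem exec_pointCode (ω : ℕ → ℕ) {Z : ℕ → ℝ} {τ : ℝ} (hτ : 0 ≤ τ) (hZ : Monotone Z)
    (hZ1 : ∀ n, 0 ≤ Z n ∧ Z n ≤ 1) {s : State} (hs : ScanInv Z τ s)
    (h14 : s.rreg 14 = Z (s.nreg 10))
    (hgap : s.nreg 10 ≤ s.nreg 9 + 1 ∨
      ∀ n, s.nreg 9 ≤ n → n ≤ s.nreg 10 → Z n = Z (s.nreg 9)) :
    ∃ T s', Exec ω pointCode s T s' ∧ T ≤ 40 ∧ ScanInv Z τ s' ∧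
      s'.nreg 9 = max (s.nreg 9) (s.nreg 10) ∧
      (∀ i, i ≠ 8 → i ≠ 9 → i ≠ 11 → s'.nreg i = s.nreg i) ∧
      s'.rreg 10 = s.rreg 10 ∧ s'.rreg 14 = s.rreg 14 ∧ s'.narr = s.narr ∧
      s'.drawn = s.drawn := by
  by_cases hlt : s.nreg 9 < s.nreg 10
  swap
  · exact ⟨_, s, .cond_false hlt (exec_skip ω s), by omega, hs, by omega, fun _ _ _ _ => rfl, rfl,
      rfl, rfl, rfl⟩
  have hgap' : s.nreg 10 = s.nreg 9 + 1 ∨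
      ∀ n, s.nreg 9 ≤ n → n ≤ s.nreg 10 → Z n = Z (s.nreg 9) :=
    hgap.imp (fun h => by omega) id
  obtain ⟨T1, r, e1, hT1, hr, h18, h19⟩ := exec_coneCode ω s hs.r20
  have hd : (0 : ℝ) < (s.nreg 10 : ℝ) - s.nreg 8 := by
    have : s.nreg 8 < s.nreg 10 := by have := hs.le; omega
    have : (s.nreg 8 : ℝ) < s.nreg 10 := by exact_mod_cast this
    linarith
  have hcone : ∀ σ, (r 18 ≤ σ ∧ σ ≤ r 19) ↔ Fits Z τ (s.nreg 8) (s.nreg 10) σ := by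
    intro σ
    rw [fits_extend_iff hs.le hlt hgap', ← hs.cone, abs_sub_mul_le_iff hd, h18, h19, max_le_iff,
      le_min_iff, h14, hs.r13, hs.r9]
    tauto
  by_cases hle : r 18 ≤ r 19
  · have e2 := exec_code ω [.radd 11 18 20, .radd 12 19 20, .nadd 9 10 13, .radd 15 14 20]
      (by simp [Instr.cost]) { s with rreg := r }
    refine ⟨_, _, .cond_true hlt (e1.seq (.cond_true hle e2)), ?_, ?_, ?_, ?_, ?_, ?_, ?_, ?_⟩
    · simp only [List.length_cons, List.length_nil]; omega
    · have h20 : r 20 = 0 := by rw [hr 20 (by omega), hs.r20]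
      constructor
      · simp [Instr.apply, hs.n5]
      · simp [Instr.apply, hs.n13]
      · simp [Instr.apply, hr, hs.r4]
      · simp [Instr.apply, h20]
      · simp [Instr.apply, hr, hs.r9]
      · simpa [Instr.apply] using hs.greedy
      · have := hs.le
        simp [Instr.apply, hs.n13]; omega
      · simp [Instr.apply, hr, hs.r13]
      · simp [Instr.apply, hs.n13, h20, hr, h14]
      · simpa [Instr.apply, hs.n13, h20] using hcone
      · simpa [Instr.apply, h20] using hle
    · simp [Instr.apply, hs.n13]; omega
    · intro i _ h9 _
      simp [Instr.apply, h9]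
    · simp [Instr.apply, hr]
    · simp [Instr.apply, hr]
    · simp [Instr.apply]
    · simp [Instr.apply]
  · have e2 := exec_code ω [.nsub 11 9 5, .emit 11 11, .rcast 16 10, .rcast 17 9, .rsub 16 16 17,
      .rsub 17 14 15, .rdiv 17 17 16, .nsub 11 10 5, .emit 11 17, .nadd 8 10 13, .nadd 9 10 13,
      .radd 13 14 20, .radd 15 14 20, .radd 11 20 20, .radd 12 4 20]
      (by simp [Instr.cost]) { s with rreg := r }
    have hno : ∀ σ, ¬ Fits Z τ (s.nreg 8) (s.nreg 10) σ := fun σ h =>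
      hle (((hcone σ).2 h).1.trans ((hcone σ).2 h).2)
    have hchord := fits_chord hτ hZ hZ1 hlt hgap'
    -- A block consisting of one gap is fitted by its chord, so a rejected block has already
    -- advanced.
    have hab : s.nreg 8 < s.nreg 9 := by
      refine lt_of_le_of_ne hs.le fun h =>
        hno ((Z (s.nreg 10) - Z (s.nreg 9)) / ((s.nreg 10 : ℝ) - s.nreg 9)) ?_
      rw [h]
      exact hchord
    have hfit := (hs.cone (s.rreg 11)).1 ⟨le_rfl, hs.cone_nonempty⟩
    have hnew := hs.greedy.step hab hlt hno hfit hchord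
    have h20 : r 20 = 0 := by rw [hr 20 (by omega), hs.r20]
    refine ⟨_, _, .cond_true hlt (e1.seq (.cond_false hle e2)), ?_, ?_, ?_, ?_, ?_, ?_, ?_, ?_⟩
    · simp only [List.length_cons, List.length_nil]; omega
    · constructor
      · simp [Instr.apply, hs.n5]
      · simp [Instr.apply, hs.n13]
      · simp [Instr.apply, hr, hs.r4]
      · simp [Instr.apply, h20]
      · simp [Instr.apply, hr, hs.r9]
      · simpa [Instr.apply, Function.update, hs.n13, hs.n5, hr, h14, hs.r15] using hnew
      · simp [Instr.apply]
      · simp [Instr.apply, hs.n13, h20, hr, h14]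
      · simp [Instr.apply, hs.n13, h20, hr, h14]
      · intro σ
        simp [Instr.apply, hs.n13, h20, hr, hs.r4, fits_refl_iff hτ]
      · simp [Instr.apply, h20, hr, hs.r4]
    · simp [Instr.apply, hs.n13]; omega
    · intro i h8 h9 h11
      simp [Instr.apply, h8, h9, h11]
    · simp [Instr.apply, hr]
    · simp [Instr.apply, hr]
    · simp [Instr.apply]
    · simp [Instr.apply]

end RealRAM

namespace RealRAM

/-! ### Scanning the samples -/

/-- Body of the scan: process the points `n₇` and `x + 1` for the next sample `x` if it differs
from the preceding one. -/
def scanBody : Prog :=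
  .seq (code [.nload 6 0 4])
    (.seq (.cond (.nle 7 6)
      (.seq (code [.rcast 17 4, .rdiv 14 17 10, .nadd 10 7 13])
        (.seq pointCode (.seq (code [.nadd 10 6 13]) (.seq pointCode (code [.nadd 7 6 5])))))
      skip) (code [.nadd 4 4 5]))

/-- Loop invariant of the scan before the sample number `i` of the sorted array `X` is read. -/
structure LoopInv (Z : ℕ → ℝ) (τ : ℝ) (X : ℕ → ℕ) (N m : ℕ) (i : ℕ) (s : State) : Prop where
  scan : ScanInv Z τ s
  n0 : s.nreg 0 = N
  n3 : s.nreg 3 = m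
  n4 : s.nreg 4 = i
  r10 : s.rreg 10 = m
  arr : s.narr 0 = X
  drawn : s.drawn = m
  prev_le : s.nreg 9 ≤ s.nreg 7
  le_prev : s.nreg 7 ≤ s.nreg 9 + 1
  lt_next : ∀ j < i, X j < s.nreg 7
  le_size : i ≤ m → s.nreg 7 ≤ N
  finished : i = m + 1 → s.nreg 9 = N

/-- Frame rule: the registers not mentioned may be used as scratch. -/
theorem ScanInv.congr {Z : ℕ → ℝ} {τ : ℝ} {s s' : State} (h : ScanInv Z τ s)
    (hn : ∀ i, i = 5 ∨ i = 8 ∨ i = 9 ∨ i = 13 → s'.nreg i = s.nreg i)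
    (hr : ∀ i, i ≠ 14 → i ≠ 17 → s'.rreg i = s.rreg i) (ho : s'.out = s.out) :
    ScanInv Z τ s' where
  n5 := by rw [hn 5 (by norm_num), h.n5]
  n13 := by rw [hn 13 (by norm_num), h.n13]
  r4 := by rw [hr 4 (by norm_num) (by norm_num), h.r4]
  r20 := by rw [hr 20 (by norm_num) (by norm_num), h.r20]
  r9 := by rw [hr 9 (by norm_num) (by norm_num), h.r9]
  greedy := by rw [hn 8 (by norm_num), ho]; exact h.greedy
  le := by rw [hn 8 (by norm_num), hn 9 (by norm_num)]; exact h.le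
  r13 := by rw [hn 8 (by norm_num), hr 13 (by norm_num) (by norm_num), h.r13]
  r15 := by rw [hn 9 (by norm_num), hr 15 (by norm_num) (by norm_num), h.r15]
  cone := by
    rw [hn 8 (by norm_num), hn 9 (by norm_num), hr 11 (by norm_num) (by norm_num),
      hr 12 (by norm_num) (by norm_num)]
    exact h.cone
  cone_nonempty := by
    rw [hr 11 (by norm_num) (by norm_num), hr 12 (by norm_num) (by norm_num)]
    exact h.cone_nonempty

section Scan

variable {Z : ℕ → ℝ} {τ : ℝ} {X : ℕ → ℕ} {N m : ℕ}

/-- After a sample `x'` the empirical distribution function can change from `x'` to `x' + 1` and is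
then flat up to the next distinct sample `x`. Testing `x' + 1` and `x` is enough, so the scan takes
time linear in the number of samples and not in `N`; repeated samples are skipped. -/
theorem exec_scanBody (ω : ℕ → ℕ) (hτ : 0 ≤ τ) (hZ : Monotone Z) (hZ1 : ∀ n, 0 ≤ Z n ∧ Z n ≤ 1)
    (hX : ∀ i j, i ≤ j → j ≤ m → X i ≤ X j) (hXN : ∀ i < m, X i < N) (hXm : X m = N)
    (hcount : ∀ i ≤ m, ∀ n, (∀ j < i, X j < n) → n ≤ X i → Z n = (i : ℝ) / m)
    {i : ℕ} (hi : i ≤ m) {s : State} (hs : LoopInv Z τ X N m i s) :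
    ∃ T s', Exec ω scanBody s T s' ∧ T ≤ 100 ∧ LoopInv Z τ X N m (i + 1) s' := by
  have e1 := exec_code ω [.nload 6 0 4] (by simp [Instr.cost]) s
  simp only [List.foldl, Instr.apply, hs.n4, hs.arr] at e1
  set s1 : State := { s with nreg := Function.update s.nreg 6 (X i) } with hs1
  have hscan1 : ScanInv Z τ s1 := hs.scan.congr
    (fun i hi => by simp only [hs1]; rw [Function.update_of_ne (by omega)]) (fun _ _ _ => rfl) rfl
  by_cases hle : s.nreg 7 ≤ X i
  · have hZc := hcount i hi (s.nreg 7) hs.lt_next hle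
    have hZx : ∀ n, s.nreg 7 ≤ n → n ≤ X i → Z n = (i : ℝ) / m := fun n h1 h2 =>
      hcount i hi n (fun j hj => (hs.lt_next j hj).trans_le h1) h2
    have e2 := exec_code ω [.rcast 17 4, .rdiv 14 17 10, .nadd 10 7 13] (by simp [Instr.cost]) s1
    obtain ⟨s2, hs2⟩ : ∃ s2, s2 = [Instr.rcast 17 4, .rdiv 14 17 10, .nadd 10 7 13].foldl
      (fun s c => c.apply ω s) s1 := ⟨_, rfl⟩
    rw [← hs2] at e2
    simp only [List.foldl, Instr.apply] at hs2
    have hn2 : ∀ i, i ≠ 10 → s2.nreg i = s1.nreg i := fun i h => by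
      rw [hs2]; simp [Function.update_of_ne h]
    have hn2' : s2.nreg 10 = s.nreg 7 := by rw [hs2]; simp [hs.scan.n13, hs1]
    have hr2 : ∀ i, i ≠ 14 → i ≠ 17 → s2.rreg i = s.rreg i := fun i h h' => by
      rw [hs2]; simp [Function.update_of_ne h, Function.update_of_ne h', hs1]
    have hr2' : s2.rreg 14 = (i : ℝ) / m := by
      rw [hs2]; simp [hs1, hs.n4, hs.r10]
    have hscan2 : ScanInv Z τ s2 :=
      hscan1.congr (fun i hi => hn2 i (by omega)) hr2 (by rw [hs2])
    have h29 : s2.nreg 9 = s.nreg 9 := by rw [hn2 9 (by norm_num), hs1]; simp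
    obtain ⟨T3, s3, e3, hT3, hscan3, h39, hn3, hr310, hr314, ha3, hd3⟩ :=
      exec_pointCode ω hτ hZ hZ1 hscan2 (by rw [hr2', hn2', hZc])
        (Or.inl (by rw [hn2', h29]; exact hs.le_prev))
    have h37 : s3.nreg 7 = s.nreg 7 := by
      rw [hn3 7 (by norm_num) (by norm_num) (by norm_num), hn2 7 (by norm_num), hs1]; simp
    have h36 : s3.nreg 6 = X i := by
      rw [hn3 6 (by norm_num) (by norm_num) (by norm_num), hn2 6 (by norm_num), hs1]; simp
    have h39' : s3.nreg 9 = s.nreg 7 := by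
      rw [h39, hn2', h29]; exact max_eq_right hs.prev_le
    have e4 := exec_code ω [.nadd 10 6 13] (by simp [Instr.cost]) s3
    simp only [List.foldl, Instr.apply, hscan3.n13, h36, add_zero] at e4
    set s4 : State := { s3 with nreg := Function.update s3.nreg 10 (X i) } with hs4
    have hn4 : ∀ i, i ≠ 10 → s4.nreg i = s3.nreg i := fun i h => by
      simp [hs4, Function.update_of_ne h]
    have hscan4 : ScanInv Z τ s4 :=
      hscan3.congr (fun i hi => hn4 i (by omega)) (fun _ _ _ => rfl) rfl
    have h410 : s4.nreg 10 = X i := by simp [hs4]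
    have h49 : s4.nreg 9 = s.nreg 7 := by rw [hn4 9 (by norm_num), h39']
    obtain ⟨T5, s5, e5, hT5, hscan5, h59, hn5, hr510, -, ha5, hd5⟩ :=
      exec_pointCode ω hτ hZ hZ1 hscan4
        (by rw [h410, hZx _ hle le_rfl]; exact hr314.trans hr2')
        (Or.inr fun n h1 h2 => by
          rw [h49] at h1 ⊢
          rw [h410] at h2
          rw [hZx n h1 h2, hZc])
    have h56 : s5.nreg 6 = X i := by
      rw [hn5 6 (by norm_num) (by norm_num) (by norm_num), hn4 6 (by norm_num), h36]
    have h59' : s5.nreg 9 = X i := by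
      rw [h59, h49, h410]; exact max_eq_right hle
    have hfix : ∀ i, i = 0 ∨ i = 3 ∨ i = 4 → s5.nreg i = s.nreg i := by
      intro i hi
      rw [hn5 i (by omega) (by omega) (by omega), hn4 i (by omega),
        hn3 i (by omega) (by omega) (by omega), hn2 i (by omega), hs1]
      simp only
      rw [Function.update_of_ne (by omega)]
    have e6 := exec_code ω [.nadd 7 6 5] (by simp [Instr.cost]) s5
    simp only [List.foldl, Instr.apply, hscan5.n5, h56] at e6
    have e7 := exec_code ω [.nadd 4 4 5] (by simp [Instr.cost])
      { s5 with nreg := Function.update s5.nreg 7 (X i + 1) }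
    simp only [List.foldl, Instr.apply] at e7
    have hb : (Test.nle 7 6).Holds s1 := by simpa [Test.Holds, hs1] using hle
    refine ⟨_, _, e1.seq (.seq (.cond_true hb (e2.seq (e3.seq (e4.seq (e5.seq e6))))) e7), ?_, ?_⟩
    · simp only [List.length_cons, List.length_nil]; omega
    · constructor
      · refine hscan5.congr (fun i hi => ?_) (fun _ _ _ => rfl) rfl
        simp only
        rw [Function.update_of_ne (by omega), Function.update_of_ne (by omega)]
      · simp [hfix, hs.n0]
      · simp [hfix, hs.n3]
      · simp [hfix, hs.n4, hscan5.n5]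
      · change s5.rreg 10 = m
        rw [hr510]
        change s3.rreg 10 = m
        rw [hr310, hr2 10 (by norm_num) (by norm_num), hs.r10]
      · change s5.narr 0 = X
        rw [ha5]
        change s3.narr 0 = X
        rw [ha3, hs2]
        exact hs.arr
      · change s5.drawn = m
        rw [hd5]
        change s3.drawn = m
        rw [hd3, hs2]
        exact hs.drawn
      · simp [h59']
      · simp [h59']
      · intro j hj
        simpa [Nat.lt_succ_iff] using hX j i (by omega) hi
      · intro h
        simpa using hXN i (by omega)
      · intro h
        obtain rfl : i = m := by omega
        simpa [hXm] using h59'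
  · have hb : ¬ (Test.nle 7 6).Holds s1 := by simpa [Test.Holds, hs1] using hle
    have e7 := exec_code ω [.nadd 4 4 5] (by simp [Instr.cost]) s1
    simp only [List.foldl, Instr.apply] at e7
    -- The sentinel `N` is never skipped, so the scan reaches the right end of the domain.
    have him : i ≠ m := by
      rintro rfl
      exact hle (hXm ▸ hs.le_size le_rfl)
    refine ⟨_, _, e1.seq (.seq (.cond_false hb (exec_skip ω s1)) e7), ?_, ?_⟩
    · simp only [List.length_cons, List.length_nil]; omega
    · constructor
      · refine hscan1.congr (fun i hi => ?_) (fun _ _ _ => rfl) rfl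
        simp only
        rw [Function.update_of_ne (by omega)]
      · simp [hs1, hs.n0]
      · simp [hs1, hs.n3]
      · simp [hs1, hs.n4, hs.scan.n5]
      · exact hs.r10
      · exact hs.arr
      · exact hs.drawn
      · simpa [hs1] using hs.prev_le
      · simpa [hs1] using hs.le_prev
      · intro j hj
        have : X j < s.nreg 7 := (hX j i (by omega) hi).trans_lt (not_le.1 hle)
        simpa [hs1] using this
      · intro _
        simpa [hs1] using hs.le_size hi
      · intro h
        omega

/-- Scan the samples and output the last interval. -/
def scanCode : Prog := .seq (.loop (.nle 4 3) scanBody) (code [.nsub 11 0 5, .emit 11 11])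

theorem exec_scanCode (ω : ℕ → ℕ) (hτ : 0 ≤ τ) (hZ : Monotone Z) (hZ1 : ∀ n, 0 ≤ Z n ∧ Z n ≤ 1)
    (hX : ∀ i j, i ≤ j → j ≤ m → X i ≤ X j) (hXN : ∀ i < m, X i < N) (hXm : X m = N)
    (hcount : ∀ i ≤ m, ∀ n, (∀ j < i, X j < n) → n ≤ X i → Z n = (i : ℝ) / m)
    {s : State} (hs : LoopInv Z τ X N m 0 s) :
    ∃ T s' o a σ, Exec ω scanCode s T s' ∧ T ≤ 101 * m + 105 ∧ s'.drawn = m ∧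
      s'.out = o ++ [(N - 1, σ)] ∧ GreedyFit Z τ o a ∧ a ≤ N ∧ Fits Z τ a N σ := by
  obtain ⟨T, s1, e1, hT, h1⟩ := exec_loop_count (ω := ω) (b := .nle 4 3) (p := scanBody)
    (fun i s => LoopInv Z τ X N m i s) (n := m + 1) (c := 100)
    (fun j hj s hs => ⟨by simp only [Test.Holds, hs.n4, hs.n3]; omega,
      exec_scanBody ω hτ hZ hZ1 hX hXN hXm hcount (by omega) hs⟩)
    (fun s hs => by simp only [Test.Holds, hs.n4, hs.n3]; omega) hs
  have e2 := exec_code ω [.nsub 11 0 5, .emit 11 11] (by simp [Instr.cost]) s1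
  have h9 := h1.finished rfl
  refine ⟨_, _, s1.out, s1.nreg 8, s1.rreg 11, e1.seq e2, ?_, ?_, ?_, h1.scan.greedy, ?_, ?_⟩
  · simp only [List.length_cons, List.length_nil]; omega
  · simpa [Instr.apply] using h1.drawn
  · simp [Instr.apply, h1.n0, h1.scan.n5]
  · rw [← h9]; exact h1.scan.le
  · rw [← h9, ← h1.scan.cone]
    exact ⟨le_rfl, h1.scan.cone_nonempty⟩

end Scan

/-! ### The sorted samples -/

theorem length_sortedBatch (ω : ℕ → ℕ) (d c : ℕ) : (sortedBatch ω d c).length = c := by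
  simp [sortedBatch]

theorem mem_sortedBatch {ω : ℕ → ℕ} {d c x : ℕ} (h : x ∈ sortedBatch ω d c) :
    ∃ i, x = ω i := by
  simp only [sortedBatch, List.mem_insertionSort, List.mem_map] at h
  obtain ⟨i, -, rfl⟩ := h
  exact ⟨_, rfl⟩

theorem sortedBatch_getD_mono (ω : ℕ → ℕ) (d c : ℕ) {i j : ℕ} (hij : i ≤ j) (hj : j < c) :
    (sortedBatch ω d c).getD i 0 ≤ (sortedBatch ω d c).getD j 0 := by
  have hl := length_sortedBatch ω d c
  have hs : (sortedBatch ω d c).Pairwise (· ≤ ·) := List.pairwise_insertionSort _ _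
  rw [List.getD_eq_getElem _ _ (by omega), List.getD_eq_getElem _ _ (by omega)]
  rcases hij.eq_or_lt with rfl | hlt
  · exact le_rfl
  · exact List.pairwise_iff_getElem.1 hs i j _ _ hlt

/-- Lets the index in the sorted array serve as the count of smaller samples. -/
theorem countP_eq_of_sorted_split {l : List ℕ} {i n : ℕ} (hi : i ≤ l.length)
    (h1 : ∀ j < i, l.getD j 0 < n) (h2 : ∀ j, i ≤ j → j < l.length → n ≤ l.getD j 0) :
    l.countP (fun x => decide (x < n)) = i := by
  rw [← List.take_append_drop i l, List.countP_append]
  have e1 : (l.take i).countP (fun x => decide (x < n)) = i := by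
    rw [List.countP_eq_length.2, List.length_take, min_eq_left hi]
    intro x hx
    obtain ⟨j, hj, rfl⟩ := List.mem_iff_getElem.1 hx
    rw [List.length_take] at hj
    have := h1 j (by omega)
    rw [List.getD_eq_getElem _ _ (by omega)] at this
    simpa using this
  have e2 : (l.drop i).countP (fun x => decide (x < n)) = 0 := by
    rw [List.countP_eq_zero]
    intro x hx
    obtain ⟨j, hj, rfl⟩ := List.mem_iff_getElem.1 hx
    rw [List.length_drop] at hj
    have := h2 (i + j) (by omega) (by omega)
    rw [List.getD_eq_getElem _ _ (by omega)] at this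
    simpa using this
  rw [e1, e2, add_zero]

theorem empCdf_eq_countP {N : ℕ} (ω : ℕ → Fin N) (m n : ℕ) :
    empCdf (fun i : Fin m => ω i) n =
      ((sortedBatch (fun i => (ω i : ℕ)) 0 m).countP (fun x => decide (x < n)) : ℝ) / m := by
  rw [empCdf, sortedBatch, (List.perm_insertionSort _ _).countP_eq, List.countP_map,
    Fin.sum_univ_eq_sum_range (fun i => if (ω i : ℕ) < n then (1 : ℝ) else 0)]
  congr 1
  induction m with
  | zero => simp
  | succ m ih =>
    rw [Finset.sum_range_succ, ih, List.range_succ, List.countP_append]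
    by_cases h : (ω m : ℕ) < n <;> simp [h]

theorem empCdf_monotone {m N : ℕ} (ω : Fin m → Fin N) : Monotone (empCdf ω) := by
  intro x y hxy
  rw [empCdf, empCdf]
  gcongr with i
  split_ifs with h1 h2 h2
  · exact le_rfl
  · omega
  · exact zero_le_one
  · exact le_rfl

theorem empCdf_mem_unit {m N : ℕ} (hm : 0 < m) (ω : Fin m → Fin N) (n : ℕ) :
    0 ≤ empCdf ω n ∧ empCdf ω n ≤ 1 := by
  have hm' : (0 : ℝ) < m := by exact_mod_cast hm
  constructor
  · exact div_nonneg (Finset.sum_nonneg fun i _ => by split_ifs <;> norm_num) hm'.le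
  · rw [empCdf, div_le_one hm']
    calc _ ≤ ∑ _i : Fin m, (1 : ℝ) := Finset.sum_le_sum fun i _ => by split_ifs <;> norm_num
      _ = m := by simp

end RealRAM

namespace RealRAM

/-! ### Choosing the parameters and drawing the samples -/

/-- Compute in `r₃` the least `L` with `N ≤ k * t * 2 ^ L`. -/
def scaleCode : Prog :=
  .seq (code [.nconst 5 1, .rcast 4 5, .rcast 21 0, .rcast 16 1, .rcast 17 2, .rmul 5 16 17,
      .radd 2 5 20])
    (.loop (.rlt 2 21) (code [.radd 2 2 2, .radd 3 3 4]))

/-- Compute in `n₃` the number of samples. -/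
def sizeCode : Prog :=
  .seq (code [.rmul 6 0 0, .rmul 6 6 0, .nconst 12 1000000000, .rcast 17 12, .rmul 7 5 3,
      .rmul 16 17 7])
    -- Without rounding, the ceiling is found by adding `ε ^ 3` until the numerator is reached, in
    -- time proportional to the result.
    (.loop (.rlt 8 16) (code [.radd 8 8 6, .nadd 3 3 5]))

/-- Compute the tolerance, draw the samples and add a sentinel. -/
def drawCode : Prog :=
  .seq (code [.nconst 12 250000, .rcast 17 12, .rmul 17 17 7, .rmul 9 0 0, .rdiv 9 9 17,
      .rcast 10 3, .radd 12 4 20])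
    (.seq (.atom (.draw 3 0)) (code [.nstore 0 3 0]))

/-- The learning program. -/
def learnCode : Prog := .seq (.seq scaleCode (.seq sizeCode drawCode)) scanCode

/-- Number of samples. -/
noncomputable def sampleSize (k t L : ℕ) (ε : ℝ) : ℕ :=
  ⌈1000000000 * ((k : ℝ) * t * L) / ε ^ 3⌉₊

/-- The state up to the draw. -/
structure SetupInv (N k t : ℕ) (ε : ℝ) (s : State) : Prop where
  n0 : s.nreg 0 = N
  n5 : s.nreg 5 = 1
  nz : ∀ i, i = 4 ∨ i = 7 ∨ i = 8 ∨ i = 9 ∨ i = 13 → s.nreg i = 0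
  r0 : s.rreg 0 = ε
  r4 : s.rreg 4 = 1
  r5 : s.rreg 5 = (k : ℝ) * t
  rz : ∀ i, i = 11 ∨ i = 13 ∨ i = 15 ∨ i = 20 → s.rreg i = 0
  narr : s.narr = fun _ _ => 0
  drawn : s.drawn = 0
  out : s.out = []

theorem SetupInv.congr {N k t : ℕ} {ε : ℝ} {s s' : State} (h : SetupInv N k t ε s)
    (hn : ∀ i, i ≠ 3 → i ≠ 12 → s'.nreg i = s.nreg i)
    (hr : ∀ i, i = 0 ∨ i = 4 ∨ i = 5 ∨ i = 11 ∨ i = 13 ∨ i = 15 ∨ i = 20 →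
      s'.rreg i = s.rreg i)
    (ha : s'.narr = s.narr) (hd : s'.drawn = s.drawn) (ho : s'.out = s.out) :
    SetupInv N k t ε s' where
  n0 := by rw [hn 0 (by norm_num) (by norm_num), h.n0]
  n5 := by rw [hn 5 (by norm_num) (by norm_num), h.n5]
  nz i hi := by rw [hn i (by omega) (by omega), h.nz i hi]
  r0 := by rw [hr 0 (by norm_num), h.r0]
  r4 := by rw [hr 4 (by norm_num), h.r4]
  r5 := by rw [hr 5 (by norm_num), h.r5]
  rz i hi := by rw [hr i (by omega), h.rz i hi]
  narr := by rw [ha, h.narr]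
  drawn := by rw [hd, h.drawn]
  out := by rw [ho, h.out]

theorem exec_scaleCode (ω : ℕ → ℕ) {N k t L : ℕ} (ε : ℝ) (hL : N ≤ k * t * 2 ^ L)
    (hmin : ∀ j < L, k * t * 2 ^ j < N) :
    ∃ T s, Exec ω scaleCode (start N k t ε) T s ∧ T ≤ 4 * L + 9 ∧ SetupInv N k t ε s ∧
      s.rreg 3 = L ∧ s.rreg 8 = 0 ∧ s.nreg 3 = 0 := by
  have e1 := exec_code ω [.nconst 5 1, .rcast 4 5, .rcast 21 0, .rcast 16 1, .rcast 17 2,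
    .rmul 5 16 17, .radd 2 5 20] (by simp [Instr.cost]) (start N k t ε)
  obtain ⟨s1, hs1⟩ : ∃ s1, s1 = [Instr.nconst 5 1, .rcast 4 5, .rcast 21 0, .rcast 16 1,
    .rcast 17 2, .rmul 5 16 17, .radd 2 5 20].foldl (fun s c => c.apply ω s) (start N k t ε) :=
    ⟨_, rfl⟩
  rw [← hs1] at e1
  obtain ⟨T, s2, e2, hT, h2⟩ := exec_loop_count (ω := ω) (b := .rlt 2 21)
    (p := code [.radd 2 2 2, .radd 3 3 4])
    (fun j s => SetupInv N k t ε s ∧ s.rreg 2 = (k : ℝ) * t * 2 ^ j ∧ s.rreg 3 = j ∧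
      s.rreg 21 = N ∧ s.rreg 8 = 0 ∧ s.nreg 3 = 0) (n := L) (c := 3)
    (by
      rintro j hj s ⟨hs, h2, h3, h21, h8, hn3⟩
      refine ⟨?_, _, _, exec_code ω _ (by simp [Instr.cost]) s, by simp, ?_, ?_, ?_, ?_, ?_, ?_⟩
      · simp only [Test.Holds, h2, h21]
        exact_mod_cast hmin j hj
      · refine hs.congr (fun _ _ _ => rfl) (fun i hi => ?_) rfl rfl rfl
        simp only [List.foldl, Instr.apply]
        rw [Function.update_of_ne (by omega), Function.update_of_ne (by omega)]
      · simp [Instr.apply, h2]; ring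
      · simp [Instr.apply, h3, hs.r4]
      · simp [Instr.apply, h21]
      · simp [Instr.apply, h8]
      · simp [Instr.apply, hn3])
    (by
      rintro s ⟨hs, h2, h3, h21, -⟩
      simp only [Test.Holds, h2, h21, not_lt]
      exact_mod_cast hL)
    (s := s1) (by
      rw [hs1]
      refine ⟨?_, ?_, ?_, ?_, ?_, ?_⟩
      · constructor
        · simp [Instr.apply, start]
        · simp [Instr.apply, start]
        · rintro i (rfl | rfl | rfl | rfl | rfl) <;> simp [Instr.apply, start]
        · simp [Instr.apply, start]
        · simp [Instr.apply, start]
        · simp [Instr.apply, start]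
        · rintro i (rfl | rfl | rfl | rfl) <;> simp [Instr.apply, start]
        · simp [Instr.apply, start]
        · simp [Instr.apply, start]
        · simp [Instr.apply, start]
      · simp [Instr.apply, start]
      · simp [Instr.apply, start]
      · simp [Instr.apply, start]
      · simp [Instr.apply, start]
      · simp [Instr.apply, start])
  refine ⟨_, s2, e1.seq e2, ?_, h2.1, h2.2.2.1, h2.2.2.2.2.1, h2.2.2.2.2.2⟩
  simp only [List.length_cons, List.length_nil]; omega

theorem exec_sizeCode (ω : ℕ → ℕ) {N k t L : ℕ} {ε : ℝ} (hε : 0 < ε) {s : State}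
    (hs : SetupInv N k t ε s) (h3 : s.rreg 3 = L) (h8 : s.rreg 8 = 0) (hn3 : s.nreg 3 = 0) :
    ∃ T s', Exec ω sizeCode s T s' ∧ T ≤ 4 * sampleSize k t L ε + 8 ∧ SetupInv N k t ε s' ∧
      s'.rreg 7 = (k : ℝ) * t * L ∧ s'.nreg 3 = sampleSize k t L ε := by
  have e1 := exec_code ω [.rmul 6 0 0, .rmul 6 6 0, .nconst 12 1000000000, .rcast 17 12,
    .rmul 7 5 3, .rmul 16 17 7] (by simp [Instr.cost]) s
  obtain ⟨s1, hs1⟩ : ∃ s1, s1 = [Instr.rmul 6 0 0, .rmul 6 6 0, .nconst 12 1000000000,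
    .rcast 17 12, .rmul 7 5 3, .rmul 16 17 7].foldl (fun s c => c.apply ω s) s := ⟨_, rfl⟩
  rw [← hs1] at e1
  have hε3 : 0 < ε ^ 3 := by positivity
  obtain ⟨T, s2, e2, hT, h2⟩ := exec_loop_count (ω := ω) (b := .rlt 8 16)
    (p := code [.radd 8 8 6, .nadd 3 3 5])
    (fun j s => SetupInv N k t ε s ∧ s.rreg 8 = j * ε ^ 3 ∧ s.nreg 3 = j ∧
      s.rreg 6 = ε ^ 3 ∧ s.rreg 16 = 1000000000 * ((k : ℝ) * t * L) ∧
      s.rreg 7 = (k : ℝ) * t * L) (n := sampleSize k t L ε) (c := 3)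
    (by
      rintro j hj s ⟨hs, h8, hn3, h6, h16, h7⟩
      refine ⟨?_, _, _, exec_code ω _ (by simp [Instr.cost]) s, by simp, ?_, ?_, ?_, ?_, ?_, ?_⟩
      · simp only [Test.Holds, h8, h16]
        rw [← lt_div_iff₀ hε3]
        exact Nat.lt_ceil.1 hj
      · refine hs.congr (fun i h _ => ?_) (fun i hi => ?_) rfl rfl rfl
        · simp only [List.foldl, Instr.apply]
          rw [Function.update_of_ne h]
        · simp only [List.foldl, Instr.apply]
          rw [Function.update_of_ne (by omega)]
      · simp [Instr.apply, h8, h6]; ring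
      · simp [Instr.apply, hn3, hs.n5]
      · simp [Instr.apply, h6]
      · simp [Instr.apply, h16]
      · simp [Instr.apply, h7])
    (by
      rintro s ⟨hs, h8, hn3, h6, h16, h7⟩
      simp only [Test.Holds, h8, h16, not_lt]
      rw [← div_le_iff₀ hε3]
      exact Nat.le_ceil _)
    (s := s1) (by
      rw [hs1]
      refine ⟨?_, ?_, ?_, ?_, ?_, ?_⟩
      · refine hs.congr (fun i _ h => ?_) (fun i hi => ?_) rfl rfl rfl
        · simp only [List.foldl, Instr.apply]
          rw [Function.update_of_ne h]
        · simp only [List.foldl, Instr.apply]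
          rw [Function.update_of_ne (by omega), Function.update_of_ne (by omega),
            Function.update_of_ne (by omega), Function.update_of_ne (by omega),
            Function.update_of_ne (by omega)]
      · simp [Instr.apply, h8]
      · simp [Instr.apply, hn3]
      · simp [Instr.apply, hs.r0]; ring
      · simp [Instr.apply, hs.r5, h3]
      · simp [Instr.apply, hs.r5, h3])
  refine ⟨_, s2, e1.seq e2, ?_, h2.1, h2.2.2.2.2.2, h2.2.2.1⟩
  simp only [List.length_cons, List.length_nil]; omega

theorem exec_drawCode {N : ℕ} (ω : ℕ → Fin N) {k t m : ℕ} {ε W τ : ℝ} {s : State}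
    (hs : SetupInv N k t ε s) (h7 : s.rreg 7 = W) (hn3 : s.nreg 3 = m)
    (hτ : ε ^ 2 / (250000 * W) = τ) (hτ0 : 0 ≤ τ) :
    ∃ T s', Exec (fun i => (ω i : ℕ)) drawCode s T s' ∧ T ≤ m + 15 ∧
      LoopInv (empCdf fun i : Fin m => ω i) τ
        (Function.update (fun j => (sortedBatch (fun i => (ω i : ℕ)) 0 m).getD j 0) m N)
        N m 0 s' := by
  set ω' : ℕ → ℕ := fun i => (ω i : ℕ)
  have e1 := exec_code ω' [.nconst 12 250000, .rcast 17 12, .rmul 17 17 7, .rmul 9 0 0,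
    .rdiv 9 9 17, .rcast 10 3, .radd 12 4 20] (by simp [Instr.cost]) s
  obtain ⟨s1, hs1⟩ : ∃ s1, s1 = [Instr.nconst 12 250000, .rcast 17 12, .rmul 17 17 7,
    .rmul 9 0 0, .rdiv 9 9 17, .rcast 10 3, .radd 12 4 20].foldl (fun s c => c.apply ω' s) s :=
    ⟨_, rfl⟩
  rw [← hs1] at e1
  have h1 : SetupInv N k t ε s1 := by
    rw [hs1]
    refine hs.congr (fun i _ h => ?_) (fun i hi => ?_) rfl rfl rfl
    · simp only [List.foldl, Instr.apply]
      rw [Function.update_of_ne h]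
    · simp only [List.foldl, Instr.apply]
      rw [Function.update_of_ne (by omega), Function.update_of_ne (by omega),
        Function.update_of_ne (by omega), Function.update_of_ne (by omega),
        Function.update_of_ne (by omega), Function.update_of_ne (by omega)]
  have h13 : s1.nreg 3 = m := by rw [hs1]; simp [Instr.apply, hn3]
  have h19 : s1.rreg 9 = τ := by
    rw [hs1, ← hτ]; simp [Instr.apply, hs.r0, h7, sq]
  have h110 : s1.rreg 10 = m := by rw [hs1]; simp [Instr.apply, hn3]
  have h112 : s1.rreg 12 = 1 := by rw [hs1]; simp [Instr.apply, hs.r4, hs.rz]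
  have e2 := Exec.atom (ω := ω') (.draw 3 0) s1
  have e3 := exec_code ω' [.nstore 0 3 0] (by simp [Instr.cost]) ((Instr.draw 3 0).apply ω' s1)
  have hZ0 : empCdf (fun i : Fin m => ω i) 0 = 0 := by simp [empCdf]
  refine ⟨_, _, e1.seq (e2.seq e3), ?_, ?_⟩
  · simp only [List.length_cons, List.length_nil, Instr.cost, h13]; omega
  · constructor
    · constructor
      · simp [Instr.apply, h1.n5]
      · simp [Instr.apply, h1.nz]
      · simp [Instr.apply, h1.r4]
      · simp [Instr.apply, h1.rz]
      · simp [Instr.apply, h19]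
      · simpa [Instr.apply, h1.out, h1.nz] using GreedyFit.nil
      · simp [Instr.apply, h1.nz]
      · simp [Instr.apply, h1.nz, h1.rz, hZ0]
      · simp [Instr.apply, h1.nz, h1.rz, hZ0]
      · intro σ
        simp [Instr.apply, h1.nz, h1.rz, h112, fits_refl_iff hτ0]
      · simp [Instr.apply, h1.rz, h112]
    · simp [Instr.apply, h1.n0]
    · simp [Instr.apply, h13]
    · simp [Instr.apply, h1.nz]
    · simp [Instr.apply, h110]
    -- The array is zero before the draw, which accounts for the default value `0`.
    · simp [Instr.apply, h13, h1.narr, h1.drawn, h1.n0]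
    · simp [Instr.apply, h13, h1.drawn]
    · simp [Instr.apply, h1.nz]
    · simp [Instr.apply, h1.nz]
    · intro j hj
      omega
    · intro _
      simp [Instr.apply, h1.nz]
    · intro h
      omega

theorem exec_learnCode {N : ℕ} (ω : ℕ → Fin N) {k t L : ℕ} {ε τ : ℝ} (hε : 0 < ε)
    (hL : N ≤ k * t * 2 ^ L) (hmin : ∀ j < L, k * t * 2 ^ j < N)
    (hm : 0 < sampleSize k t L ε)
    (hτ : ε ^ 2 / (250000 * ((k : ℝ) * t * L)) = τ) (hτ0 : 0 ≤ τ) :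
    ∃ T s' o a σ, Exec (fun i => (ω i : ℕ)) learnCode (start N k t ε) T s' ∧
      T ≤ 4 * L + 106 * sampleSize k t L ε + 137 ∧ s'.drawn = sampleSize k t L ε ∧
      s'.out = o ++ [(N - 1, σ)] ∧
      GreedyFit (empCdf fun i : Fin (sampleSize k t L ε) => ω i) τ o a ∧ a ≤ N ∧
      Fits (empCdf fun i : Fin (sampleSize k t L ε) => ω i) τ a N σ := by
  obtain ⟨T1, s1, e1, hT1, h1, h13, h18, hn13⟩ :=
    exec_scaleCode (fun i => (ω i : ℕ)) ε hL hmin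
  obtain ⟨T2, s2, e2, hT2, h2, h27, hn23⟩ :=
    exec_sizeCode (fun i => (ω i : ℕ)) hε h1 h13 h18 hn13
  obtain ⟨T3, s3, e3, hT3, h3⟩ := exec_drawCode ω h2 h27 hn23 hτ hτ0
  set m := sampleSize k t L ε
  set ω' : ℕ → ℕ := fun i => (ω i : ℕ)
  have hX : ∀ j < m, Function.update (fun j => (sortedBatch ω' 0 m).getD j 0) m N j =
      (sortedBatch ω' 0 m).getD j 0 := fun j hj => Function.update_of_ne hj.ne _ _
  have hlt : ∀ j < m, (sortedBatch ω' 0 m).getD j 0 < N := by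
    intro j hj
    rw [List.getD_eq_getElem _ _ (by rwa [length_sortedBatch])]
    obtain ⟨i, hi⟩ := mem_sortedBatch (List.getElem_mem
      (show j < (sortedBatch ω' 0 m).length by rwa [length_sortedBatch]))
    rw [hi]
    exact (ω i).2
  have hmono : ∀ i j, i ≤ j → j ≤ m →
      Function.update (fun j => (sortedBatch ω' 0 m).getD j 0) m N i ≤
        Function.update (fun j => (sortedBatch ω' 0 m).getD j 0) m N j := by
    intro i j hij hj
    rcases hj.eq_or_lt with rfl | hj
    · rw [Function.update_self]
      rcases hij.eq_or_lt with rfl | hi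
      · rw [Function.update_self]
      · rw [hX i hi]; exact (hlt i hi).le
    · rw [hX i (by omega), hX j hj]
      exact sortedBatch_getD_mono _ _ _ hij hj
  obtain ⟨T4, s4, o, a, σ, e4, hT4, hd, ho, hg, ha, hf⟩ := exec_scanCode ω' hτ0
    (empCdf_monotone fun i : Fin m => ω i) (empCdf_mem_unit hm _) hmono
    (fun i hi => by rw [hX i hi]; exact hlt i hi) (Function.update_self _ _ _)
    (fun i hi n h1 h2 => by
      rw [empCdf_eq_countP ω m n, countP_eq_of_sorted_split (i := i)]
      · rwa [length_sortedBatch]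
      · intro j hj
        have := h1 j hj
        rwa [hX j (by omega)] at this
      · intro j hij hj
        rw [length_sortedBatch] at hj
        have := h2.trans (hmono i j hij hj.le)
        rwa [hX j hj] at this) h3
  exact ⟨_, s4, o, a, σ, (e1.seq (e2.seq e3)).seq e4, by omega, hd, ho, hg, ha, hf⟩

theorem hypothesis_eq_pieceValue {N : ℕ} (o : List (ℕ × ℝ)) (x : Fin N) :
    hypothesis o x = pieceValue o x := rfl

end RealRAM

/-! ### The learning guarantee -/

/-- The uniform distribution is a member. Without one there would be no near-minimiser, the infimum
of the empty set being `0`. -/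
theorem modalMixtures_nonempty {N k t : ℕ} (hN : 0 < N) (hk : 0 < k) (ht : 1 ≤ t) :
    (modalMixtures N k t).Nonempty := by
  classical
  have hN' : (N : ℝ) ≠ 0 := by positivity
  have : Nonempty (Fin N) := ⟨⟨0, hN⟩⟩
  refine ⟨_, Pi.single (⟨0, hk⟩ : Fin k) 1, single_mem_stdSimplex ℝ _,
    fun _ _ => (1 : ℝ) / N, fun _ => ⟨⟨fun _ => by positivity, by simp [hN']⟩, ?_⟩, rfl⟩
  refine ⟨Finpartition.indiscrete Finset.univ_nonempty.ne_empty, ?_, ?_⟩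
  · simpa [Finpartition.indiscrete] using ht
  · intro J hJ
    obtain rfl : J = Finset.univ := by simpa [Finpartition.indiscrete] using hJ
    refine ⟨by simpa using Set.ordConnected_univ, ⟨0, hN⟩, by simp, ?_, ?_⟩
    · exact fun _ _ _ _ _ => le_rfl
    · exact fun _ _ _ _ _ => le_rfl

theorem exists_mem_l1Dist_lt {N : ℕ} {𝒞 : Set (Fin N → ℝ)} (h : 𝒞.Nonempty) (f : Fin N → ℝ)
    {c : ℝ} (hc : 0 < c) : ∃ q ∈ 𝒞, l1Dist q f < OPT 𝒞 f + c := by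
  obtain ⟨_, ⟨q, hq, rfl⟩, hlt⟩ := exists_lt_of_csInf_lt (h.image fun q => l1Dist q f)
    (show sInf ((fun q => l1Dist q f) '' 𝒞) < OPT 𝒞 f + c from lt_add_of_pos_right _ hc)
  exact ⟨q, hq, hlt⟩

/-- The factor `12` is `11` for the noise, in which the distance to `g` is included, plus `1` for
passing from `g` back to `f`. -/
theorem l1Dist_hypothesis_le {N m : ℕ} (hm : 0 < m) {f : Fin N → ℝ} (hf0 : ∀ x, 0 ≤ f x)
    (hf1 : ∑ x, f x = 1) {g : ℕ → ℝ} (hg : ∀ x, 0 ≤ g x ∧ g x ≤ 1) {l : ℝ} (hl : 0 < l)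
    (ω : Fin m → Fin N) {o : List (ℕ × ℝ)} {a : ℕ} {σ : ℝ}
    (ho : GreedyFit (empCdf ω) (4 * l) o a) (ha : a ≤ N)
    (hfit : Fits (empCdf ω) (4 * l) a N σ) :
    l1Dist (RealRAM.hypothesis (o ++ [(N - 1, σ)])) f ≤
      30 * l * jumpCount g N + 10 * l + 11 * fluctuation (extendZero f) l ω N +
        12 * ∑ x ∈ Finset.range N, |extendZero f x - g x| := by
  set p := extendZero f with hpdef
  have hp0 : ∀ x, 0 ≤ p x := extendZero_nonneg hf0
  have hp : prefixSum p N = 1 := by rw [hpdef, prefixSum_extendZero, hf1]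
  set D := prefixSum fun x => |p x - g x|
  have hDmono : Monotone D := prefixSum_monotone fun x => abs_nonneg _
  have hD : ∀ a b, a ≤ b →
      |(prefixSum p b - prefixSum p a) - (prefixSum g b - prefixSum g a)| ≤ D b - D a := by
    intro a b hab
    simp only [D, prefixSum]
    rw [← Finset.sum_Ico_eq_sub _ hab, ← Finset.sum_Ico_eq_sub _ hab,
      ← Finset.sum_Ico_eq_sub _ hab, ← Finset.sum_sub_distrib]
    exact Finset.abs_sum_le_sum_abs _ _
  -- The misfit `D` is monotone and additive over intervals just like the fluctuation, so their sum
  -- serves as the noise function.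
  have key := ho.sum_abs_sub_le_of_fits (W := fun n => fluctuation p l ω n + D n) hl
    (fun a b hab hb => add_le_add (fluctuation_monotone hp0 hp l ω hab hb) (hDmono hab))
    (by rw [fluctuation_zero, zero_add]; exact prefixSum_zero _) (fun x _ => hg x)
    (fun a b hab hb => by
      have h1 := empCdf_increment_le hm hp0 hp hl ω hab hb
      have h2 := hD a b hab
      calc _ = |((empCdf ω b - prefixSum p b) - (empCdf ω a - prefixSum p a)) +
            ((prefixSum p b - prefixSum p a) - (prefixSum g b - prefixSum g a))| := by ring_nf
        _ ≤ _ := (abs_add_le _ _).trans (by linarith)) ha hfit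
  have hl1 : l1Dist (RealRAM.hypothesis (o ++ [(N - 1, σ)])) f ≤
      ∑ x ∈ Finset.range N, |pieceValue (o ++ [(N - 1, σ)]) x - g x| + D N := by
    have e : l1Dist (RealRAM.hypothesis (o ++ [(N - 1, σ)])) f =
        ∑ x ∈ Finset.range N, |pieceValue (o ++ [(N - 1, σ)]) x - p x| := by
      rw [l1Dist, ← Fin.sum_univ_eq_sum_range
        (fun x => |pieceValue (o ++ [(N - 1, σ)]) x - p x|)]
      exact Finset.sum_congr rfl fun x _ => by
        rw [RealRAM.hypothesis_eq_pieceValue, hpdef, extendZero_val]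
    rw [e]
    simp only [D, prefixSum]
    rw [← Finset.sum_add_distrib]
    refine Finset.sum_le_sum fun x _ => ?_
    rw [abs_sub_comm (p x)]
    exact abs_sub_le _ _ _
  have hDN : D N = ∑ x ∈ Finset.range N, |p x - g x| := rfl
  rw [hDN] at key hl1
  linarith

theorem exists_histogram_near_of_OPT {N k t L : ℕ} (hk : 1 ≤ k) (ht : 1 ≤ t) (hL : 1 ≤ L)
    (hN0 : 0 < N) (hN : N ≤ k * t * 2 ^ L) {ε : ℝ} (hε : 0 < ε) (hε1 : ε ≤ 1) (f : Fin N → ℝ) :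
    ∃ g : ℕ → ℝ, (∀ x, 0 ≤ g x ∧ g x ≤ 1) ∧
      (jumpCount g N : ℝ) ≤ 4200 * (k * t * L) / ε ∧
      ∑ x ∈ Finset.range N, |extendZero f x - g x| ≤ OPT (modalMixtures N k t) f + ε / 50 := by
  obtain ⟨q, hq, hlt⟩ := exists_mem_l1Dist_lt (modalMixtures_nonempty hN0 hk ht) f
    (show 0 < ε / 100 by positivity)
  -- The rounding error `2 * δ = ε / 100` and the slack `ε / 100` of the near-minimiser add up to `ε
  -- / 50`.
  obtain ⟨g, hg, hj, hs⟩ := exists_histogram_near hL hN0 hN (δ := ε / 200) (by positivity)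
    (by linarith) hq
  refine ⟨g, hg, hj.trans (le_of_eq (by field_simp; ring)), ?_⟩
  have e : l1Dist q f = ∑ x ∈ Finset.range N, |extendZero q x - extendZero f x| := by
    rw [l1Dist, ← Fin.sum_univ_eq_sum_range (fun x => |extendZero q x - extendZero f x|)]
    exact Finset.sum_congr rfl fun x _ => by rw [extendZero_val, extendZero_val]
  calc ∑ x ∈ Finset.range N, |extendZero f x - g x|
      ≤ ∑ x ∈ Finset.range N, (|extendZero q x - extendZero f x| + |extendZero q x - g x|) :=
        Finset.sum_le_sum fun x _ => by
          rw [abs_sub_comm (extendZero q x) (extendZero f x)]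
          exact abs_sub_le _ _ _
    _ ≤ _ := by
      rw [Finset.sum_add_distrib, ← e]
      linarith

/-- With probability at least `9/10` the empirical distribution function fluctuates little. -/
theorem fluctuation_probability {N m : ℕ} (hm : 0 < m) (f : PMF (Fin N)) {l : ℝ} (hl : 0 < l) :
    9 / 10 ≤ (Measure.infinitePi fun _ : ℕ => f.toMeasure).real
      {ω : ℕ → Fin N | fluctuation (extendZero fun x => (f x).toReal) l
        (fun i : Fin m => ω i) N ≤ 10 * (1 / (l * m) + 2 / √m)} := by
  classical
  set p := extendZero fun x => (f x).toReal with hpdef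
  have hp0 : ∀ x, 0 ≤ p x := extendZero_nonneg fun _ => ENNReal.toReal_nonneg
  have hsum : ∑ x, (f x).toReal = 1 := by
    rw [← ENNReal.toReal_sum fun x _ => f.apply_ne_top x, ← tsum_fintype (L := .unconditional _),
      f.tsum_coe, ENNReal.toReal_one]
  have hp : prefixSum p N = 1 := by rw [hpdef, prefixSum_extendZero, hsum]
  have hm' : (0 : ℝ) < m := by exact_mod_cast hm
  set e := 1 / (l * m) + 2 / √(m : ℝ)
  have he : 0 < e := by positivity
  have hmark := sampleExp_markov (m := m) (p := fun a : Fin N => p a) (fun a => hp0 a)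
    (sum_fin_pmf hp) (fun ω => fluctuation p l ω N)
    (fun ω => by
      rw [← fluctuation_zero (p := p) l ω]
      exact fluctuation_monotone hp0 hp l ω (Nat.zero_le _) le_rfl)
    (show 0 < 10 * e by positivity) (sampleExp_fluctuation_le hm hp0 hp hl)
  have hval : 1 - e / (10 * e) = 9 / 10 := by
    field_simp
    norm_num
  have hmeas := infinitePi_real_first_samples f m
    (Finset.univ.filter fun v : Fin m → Fin N => fluctuation p l v N ≤ 10 * e)
  simp only [Finset.mem_filter, Finset.mem_univ, true_and] at hmeas
  rw [hmeas, ← hval]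
  refine hmark.trans (le_of_eq ?_)
  refine Finset.sum_congr rfl fun v _ => Finset.prod_congr rfl fun i _ => ?_
  rw [hpdef, extendZero_val]

/-- The least `L` with `N ≤ n * 2 ^ L`. -/
theorem exists_dyadic_scale {n N : ℕ} (hn : 1 ≤ n) (hN : 2 * n ≤ N) :
    ∃ L : ℕ, 1 ≤ L ∧ N ≤ n * 2 ^ L ∧ (∀ j < L, n * 2 ^ j < N) ∧
      (L : ℝ) ≤ 3 * Real.log (N / n) := by
  have hex : ∃ L, N ≤ n * 2 ^ L :=
    ⟨N, (Nat.lt_two_pow_self).le.trans (Nat.le_mul_of_pos_left _ hn)⟩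
  classical
  have hmin : ∀ j < Nat.find hex, n * 2 ^ j < N := fun j hj => not_le.1 (Nat.find_min hex hj)
  have hL1 : 1 ≤ Nat.find hex := by
    rw [Nat.one_le_iff_ne_zero]
    intro h0
    have := Nat.find_spec hex
    rw [h0] at this
    omega
  refine ⟨Nat.find hex, hL1, Nat.find_spec hex, hmin, ?_⟩
  set L := Nat.find hex
  have hn' : (0 : ℝ) < n := by exact_mod_cast hn
  have h1 : Real.log 2 ≤ Real.log (N / n) := by
    apply Real.log_le_log (by norm_num)
    rw [le_div_iff₀ hn']
    exact_mod_cast hN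
  -- Minimality bounds `L - 1`; the missing `log 2` is at most `log (N / n)` by `h1`, and `2 / log 2
  -- < 3`.
  have h2 : ((L - 1 : ℕ) : ℝ) * Real.log 2 ≤ Real.log (N / n) := by
    rw [← Real.log_pow]
    apply Real.log_le_log (by positivity)
    rw [le_div_iff₀ hn', mul_comm]
    exact_mod_cast (hmin (L - 1) (by omega)).le
  rw [Nat.cast_sub hL1, Nat.cast_one] at h2
  have := Real.log_two_gt_d9
  have hL' : (1 : ℝ) ≤ L := by exact_mod_cast hL1
  nlinarith

theorem mainTheorem7 :
    ∃ (P : RealRAM.Prog) (C A B : ℝ), 1 ≤ C ∧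
      ∀ (N k t : ℕ) (ε : ℝ), 1 ≤ k → 1 ≤ t → 2 * (k * t) ≤ N → 0 < ε → ε ≤ 1 / 2 →
        AgnosticallyLearns P (RealRAM.start N k t ε) (modalMixtures N k t) C ε ∧
        ∀ ω : ℕ → Fin N, ∃ (T : ℕ) (s' : RealRAM.State),
          RealRAM.Exec (fun i => (ω i : ℕ)) P (RealRAM.start N k t ε) T s' ∧
          (s'.drawn : ℝ) ≤ A * ((k * t : ℝ) * Real.log (N / (k * t)) / ε ^ 3) ∧
          (T : ℝ) ≤ B * ((k * t : ℝ) * Real.log (N / (k * t)) / ε ^ 3 * Real.log (1 / ε)) := by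
  refine ⟨RealRAM.learnCode, 12, 4000000000, 4000000000000, by norm_num, ?_⟩
  intro N k t ε hk ht hN hε hε2
  have hkt : 1 ≤ k * t := Nat.mul_pos hk ht
  obtain ⟨L, hL1, hL, hmin, hLlog⟩ := exists_dyadic_scale hkt hN
  rw [Nat.cast_mul] at hLlog
  have hkt' : (1 : ℝ) ≤ (k : ℝ) * t := by exact_mod_cast hkt
  have hL1' : (1 : ℝ) ≤ L := by exact_mod_cast hL1
  set W : ℝ := (k : ℝ) * t * L with hWdef
  have hLW : (L : ℝ) ≤ W := by nlinarith
  have hW : 1 ≤ W := hL1'.trans hLW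
  set m := RealRAM.sampleSize k t L ε with hmdef
  have hε3 : 0 < ε ^ 3 := by positivity
  have hε3' : ε ^ 3 ≤ 1 := pow_le_one₀ hε.le (by linarith)
  have hmge : 1000000000 * W / ε ^ 3 ≤ m := Nat.le_ceil _
  have hmle : (m : ℝ) ≤ 1000000000 * W / ε ^ 3 + 1 :=
    (Nat.ceil_lt_add_one (by positivity)).le
  have hWε : W ≤ W / ε ^ 3 := by
    rw [le_div_iff₀ hε3]
    nlinarith
  rw [mul_div_assoc] at hmge hmle
  have hm0 : 0 < m := by
    have : (0 : ℝ) < m := by linarith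
    exact_mod_cast this
  -- Small enough that `l` times the `O(W/ε)` jumps is a fraction of `ε`, and large enough that `1 /
  -- (l * m)` is too.
  set l : ℝ := ε ^ 2 / (1000000 * W) with hldef
  have hl : 0 < l := by positivity
  have hτ : ε ^ 2 / (250000 * W) = 4 * l := by
    rw [hldef]
    field_simp
    norm_num
  constructor
  · intro f
    -- Monotonicity needs no measurability of the event of success.
    refine (fluctuation_probability hm0 f hl).trans (measureReal_mono ?_)
    intro ω hω
    obtain ⟨T, s', o, a, σ, he, -, -, ho, hg, ha, hfit⟩ :=
      RealRAM.exec_learnCode ω hε hL hmin hm0 hτ (by positivity)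
    refine ⟨T, s', he, ?_⟩
    rw [ho]
    obtain ⟨g, hg01, hj, hs⟩ := exists_histogram_near_of_OPT hk ht hL1 (by omega) hL hε
      (by linarith) fun x => (f x).toReal
    have hsum : ∑ x, (f x).toReal = 1 := by
      rw [← ENNReal.toReal_sum fun x _ => f.apply_ne_top x,
        ← tsum_fintype (L := .unconditional _), f.tsum_coe, ENNReal.toReal_one]
    have key := l1Dist_hypothesis_le hm0 (fun x => ENNReal.toReal_nonneg) hsum hg01 hl
      (fun i : Fin m => ω i) hg ha hfit
    have hω : fluctuation (extendZero fun x => (f x).toReal) l (fun i : Fin m => ω i) N ≤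
      10 * (1 / (l * m) + 2 / √m) := hω
    have b1 : 30 * l * jumpCount g N ≤ 126 / 1000 * ε := by
      calc 30 * l * jumpCount g N ≤ 30 * l * (4200 * W / ε) := by gcongr
        _ = 126 / 1000 * ε := by
          rw [hldef]
          field_simp
          norm_num
    have b2 : 10 * l ≤ 1 / 1000 * ε := by
      rw [hldef, ← mul_div_assoc, div_le_iff₀ (by positivity)]
      nlinarith
    have b3 : 1 / (l * m) ≤ ε / 1000 := by
      have : 1000 / ε ≤ l * m := by
        calc 1000 / ε = l * (1000000000 * (W / ε ^ 3)) := by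
              rw [hldef]
              field_simp
              norm_num
          _ ≤ l * m := by gcongr
      calc 1 / (l * m) ≤ 1 / (1000 / ε) := by gcongr
        _ = ε / 1000 := by field_simp
    have b4 : 2 / √(m : ℝ) ≤ ε / 15000 := by
      have : 30000 / ε ≤ √(m : ℝ) := by
        apply Real.le_sqrt_of_sq_le
        refine le_trans ?_ hmge
        have h1 : (30000 / ε) ^ 2 = 900000000 * ε / ε ^ 3 := by
          field_simp
          norm_num
        rw [h1, ← mul_div_assoc]
        exact div_le_div_of_nonneg_right (by linarith) hε3.le
      calc 2 / √(m : ℝ) ≤ 2 / (30000 / ε) := by gcongr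
        _ = ε / 15000 := by
          field_simp
          norm_num
    -- The contributions are `0.126 ε` from jumps, `0.001 ε` from the last block, less than `0.12 ε`
    -- from the fluctuation and `12 * ε / 50` from `hs`, in total less than `ε`.
    linarith
  · intro ω
    obtain ⟨T, s', o, a, σ, he, hT, hd, -⟩ :=
      RealRAM.exec_learnCode ω hε hL hmin hm0 hτ (by positivity)
    refine ⟨T, s', he, ?_, ?_⟩
    all_goals
      set K : ℝ := (k * t : ℝ) * Real.log (N / (k * t)) / ε ^ 3
      have hWK : W / ε ^ 3 ≤ 3 * K := by
        have h1 : W ≤ 3 * ((k * t : ℝ) * Real.log (N / (k * t))) := by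
          rw [hWdef]
          nlinarith
        calc W / ε ^ 3 ≤ 3 * ((k * t : ℝ) * Real.log (N / (k * t))) / ε ^ 3 := by gcongr
          _ = 3 * K := mul_div_assoc _ _ _
    · rw [hd]
      linarith
    -- The running time is already linear in `m + L`; the logarithm only has to be bounded below.
    · have hlog : 1 / 2 ≤ Real.log (1 / ε) := by
        have h1 : Real.log 2 ≤ Real.log (1 / ε) := by
          apply Real.log_le_log (by norm_num)
          rw [le_div_iff₀ hε]
          linarith
        linarith [Real.log_two_gt_d9]
      have hT' : (T : ℝ) ≤ 4 * L + 106 * m + 137 := by exact_mod_cast hT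
      have hK : 0 ≤ K := by linarith
      have := mul_le_mul_of_nonneg_left hlog hK
      linarith
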